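/- Let $K$ be a field and let $(R,\mathfrak m,\Bbbk)$ be an algebra with pseudocoefficient field $K$: that is, $R\neq 0$ is a commutative $K$-algebra which is either $\mathbb N$-graded with $R_0=K$ and finitely generated over $K$, with $\mathfrak m=\bigoplus_{i>0}R_i$, or local and essentially of finite type over $K$, with maximal ideal $\mathfrak m$; and $K\to\Bbbk=R/\mathfrak m$ is a finite separable field extension. Assume that $R$ is a domain and that $\operatorname{Frac}(R)$ is a separable (not necessarily algebraic) extension of $K$, i.e. every finitely generated subextension is separably generated. For $n\ge 0$ let $D^n_{R|K}\subseteq\operatorname{Hom}_K(R,R)$ be the $K$-linear differential operators of order at most $n$ ($D^0_{R|K}=\operatorname{Hom}_R(R,R)$, and $\delta\in D^{n}_{R|K}$ iff $[\delta,r]\in D^{n-1}_{R|K}$ for all $r\in R$). For $n\geq 1$ let $\mathfrak m^{\langle n\rangle_K}=\{f\in R : \delta(f)\in\mathfrak m\text{ for all }\delta\in D^{n-1}_{R|K}\}$. For $n \geq 0$ let $P^n_{R|K}=(R\otimes_K R)/\Delta^{n+1}$, where $\Delta$ is the kernel of the multiplication map $R\otimes_K R\to R$, regarded as an $R$-module through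 the left factor. Call $R$ smooth over $K$ if it is flat over $K$ and $\Omega_{R|K}$ is a projective $R$-module. Then $\mathfrak m^{\langle n\rangle_K}=\mathfrak m^n$ for some $n\ge 2$ if and only if $R$ is smooth over $K$. Furthermore, if $\Bbbk$ is perfect, these conditions are equivalent to $P^n_{R|K}$ being a free $R$-module for some $n\ge 1$. -/

import Mathlib

open scoped TensorProduct

/-- `(R, m)` is an algebra with pseudocoefficient field `K`: either `R` is `ℕ`-graded with
`R₀ = K`, finitely generated as a `K`-algebra, and `m` is the homogeneous maximal ideal
`⨁_{i > 0} Rᵢ`; or `R` is local, essentially of finite type over `K`, and `m` is its maximal ideal.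
In both cases `K → R ⧸ m` is finite and separable. -/
structure IsPseudocoefficientAlgebra (K R : Type*) [Field K] [CommRing R] [Algebra K R]
    (m : Ideal R) : Prop where
  nontrivial : Nontrivial R
  graded_or_local :
    (∃ (𝒜 : ℕ → Submodule K R) (_ : GradedAlgebra 𝒜),
      𝒜 0 = 1 ∧ Algebra.FiniteType K R ∧ m = (HomogeneousIdeal.irrelevant 𝒜).toIdeal) ∨
    (∃ _ : IsLocalRing R, Algebra.EssFiniteType K R ∧ m = IsLocalRing.maximalIdeal R)
  finite_residue : Module.Finite K (R ⧸ m)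
  separable_residue : Algebra.IsSeparable K (R ⧸ m)

theorem IsPseudocoefficientAlgebra.isMaximal {K R : Type*} [Field K] [CommRing R] [Algebra K R]
    {m : Ideal R} (h : IsPseudocoefficientAlgebra K R m) : m.IsMaximal := by
  have := h.nontrivial
  rcases h.graded_or_local with ⟨𝒜, _, h0, -, rfl⟩ | ⟨_, -, rfl⟩
  · rw [Ideal.isMaximal_iff]
    refine ⟨fun h1 => ?_, fun J x hJ hx hxJ => ?_⟩
    · rw [HomogeneousIdeal.mem_iff, HomogeneousIdeal.mem_irrelevant_iff, GradedRing.proj_apply,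
        DirectSum.decompose_of_mem_same 𝒜 (SetLike.one_mem_graded 𝒜)] at h1
      exact one_ne_zero h1
    · have hmem : (DirectSum.decompose 𝒜 x 0 : R) ∈ 𝒜 0 := SetLike.coe_mem _
      obtain ⟨c, hc⟩ := Submodule.mem_one.mp (h0.le hmem)
      have hc0 : c ≠ 0 := by
        rintro rfl
        apply hx
        rw [HomogeneousIdeal.mem_iff, HomogeneousIdeal.mem_irrelevant_iff, GradedRing.proj_apply,
          ← hc, map_zero]
      have hd : x - algebraMap K R c ∈ J := by
        apply hJ
        rw [HomogeneousIdeal.mem_iff, HomogeneousIdeal.mem_irrelevant_iff, map_sub,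
          GradedRing.proj_apply, GradedRing.proj_apply, hc,
          DirectSum.decompose_of_mem_same 𝒜 hmem, sub_self]
      have hcJ : algebraMap K R c ∈ J := by
        have := J.sub_mem hxJ hd
        simpa using this
      have := J.mul_mem_left (algebraMap K R c⁻¹) hcJ
      rwa [← map_mul, inv_mul_cancel₀ hc0, map_one] at this
  · infer_instance

/-- `δ : R → R` is a `K`-linear differential operator of order at most `n`. -/
def IsDiffOp (K : Type*) {R : Type*} [CommRing K] [CommRing R] [Algebra K R] :
    ℕ → (R →ₗ[K] R) → Prop
  | 0, δ => ∀ r x : R, δ (r * x) = r * δ x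
  | n + 1, δ => ∀ r : R,
      IsDiffOp K n (δ ∘ₗ LinearMap.mulLeft K r - LinearMap.mulLeft K r ∘ₗ δ)

theorem IsDiffOp.comp_mulLeft {K R : Type*} [CommRing K] [CommRing R] [Algebra K R] {n : ℕ}
    {δ : R →ₗ[K] R} (h : IsDiffOp K n δ) (r : R) : IsDiffOp K n (δ ∘ₗ LinearMap.mulLeft K r) := by
  induction n generalizing δ with
  | zero =>
    intro s x
    have h' : ∀ r x : R, δ (r * x) = r * δ x := h
    simp only [LinearMap.comp_apply, LinearMap.mulLeft_apply]
    rw [mul_left_comm, h']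
  | succ n ih =>
    intro s
    have := ih (h s)
    convert this using 1
    ext x
    simp [mul_left_comm]

/-- The `n`-th `K`-linear differential power of the ideal `I`, for `n ≥ 1`: the elements that every
`K`-linear differential operator of order at most `n - 1` sends into `I`. -/
def differentialPower (K : Type*) {R : Type*} [CommRing K] [CommRing R] [Algebra K R]
    (I : Ideal R) (n : ℕ) : Ideal R where
  carrier := {f | ∀ δ : R →ₗ[K] R, IsDiffOp K (n - 1) δ → δ f ∈ I}
  zero_mem' := fun δ _ => by simp
  add_mem' := fun {a b} ha hb δ hδ => by
    rw [map_add]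
    exact I.add_mem (ha δ hδ) (hb δ hδ)
  smul_mem' := fun r f hf δ hδ => hf _ (hδ.comp_mulLeft r)

/-- The module of principal parts `(R ⊗[K] R) ⧸ Δ ^ (n + 1)`, where `Δ` is the kernel of the
multiplication map `R ⊗[K] R → R`. It is an `R`-module through the left tensor factor. -/
abbrev PrincipalParts (K R : Type*) [CommRing K] [CommRing R] [Algebra K R] (n : ℕ) : Type _ :=
  (R ⊗[K] R) ⧸ (RingHom.ker (Algebra.TensorProduct.lmul' K : R ⊗[K] R →ₐ[K] R)) ^ (n + 1)

/-- A (not necessarily algebraic) field extension `F / K` is separable if every finitely generated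
subextension `E / K` is separably generated, i.e. has a transcendence basis `s` such that `E` is
separable algebraic over `K(s)`. -/
def IsSeparableExtension (K F : Type*) [Field K] [Field F] [Algebra K F] : Prop :=
  ∀ E : IntermediateField K F, E.FG →
    ∃ s : Set E, IsTranscendenceBasis K (Subtype.val : s → E) ∧
      Algebra.IsSeparable (IntermediateField.adjoin K s) E

/-- Smoothness over `K` of an algebra essentially of finite type: `R` is flat over `K` and
`Ω[R⁄K]` is a projective `R`-module. -/
def IsSmoothOver (K R : Type*) [CommRing K] [CommRing R] [Algebra K R] : Prop :=
  Module.Flat K R ∧ Module.Projective R (Ω[R⁄K])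

/-!
The theorem compares the fibre of the modules of principal parts `P^n` at `m` with their generic
rank. Let `F` be the fraction field of `R` and `d` the dimension of `Ω[F⁄K]`. Separability makes
`F` formally smooth over `K`, so that the Taylor expansion of order one lifts to all orders and the
monomials of degree at most `n` in `d` differentials `1 ⊗ x i - x i ⊗ 1` are a basis of the principal
parts of `F` (`eq_zero_of_sum_smul_mon_diffTensor_mem`). Hence `P^n` has the generic rank
`numMonomials d n`, and by Nakayama's lemma its fibre `P^n ⧸ m P^n` has at least this dimension, for
every `n` (`numMonomials_le_card`).

Say that functionals detect the fibre if every element of `P^n` outside `m P^n` is sent outside `m`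
by some linear map `P^n → R`. Then a basis of the fibre lifts to an independent family, so that the
dimension of the fibre is at most the generic rank (`linearIndependent_of_detects`). Functionals
detect the fibre if `P^n` is projective, and also if `m^⟨n + 1⟩ = m^(n + 1)`: a differential operator
of order at most `n` is a functional on `P^n`, and as `R ⧸ m` is separable over `K`, every element of
the fibre is the class of some `1 ⊗ f` (`exists_sub_fibreRight_mem_pow`).

So either condition, for one order `N ≥ 1`, gives equality of the dimension of the fibre and the
generic rank in order `N`, besides the inequality in all orders. Standard monomials show that then
`Ω[R⁄K] ⧸ m Ω[R⁄K]` has dimension at most `d` (`le_of_numMonomials_le`). The fibres of the `P^n` are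
truncations of `A = (R ⧸ m) ⊗[K] R`, and have as bases the standard monomials in minimal generators
of the augmentation ideal of `A`. The exponents of these form a down-closed set, which by its growth
contains all monomials in some `d` variables (`IsLowerSet.exists_embDomain_mem`); these alone exhaust
the dimension in order `N`, so there is no further generator. No dimension theory is needed.

Now `Ω[R⁄K]` is generated by `d` elements, by Nakayama's lemma or by an argument with homogeneous
generators, and as `d` is its generic rank, it is free
(`IsPseudocoefficientAlgebra.free_kaehlerDifferential`). Conversely, if `Ω[R⁄K]` is projective, the
same argument shows that it is free. Then `P^1 = R × Ω[R⁄K]` is free, and derivations detect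
`m ⧸ m ^ 2`, which embeds into the fibre of `Ω[R⁄K]`, so that `m^⟨2⟩ = m ^ 2`
(`differentialPower_two_eq`).
-/

/-! ### Exponent vectors and down-closed sets -/

theorem Finsupp.finite_setOf_degree_le (σ : Type*) [Finite σ] (n : ℕ) :
    {a : σ →₀ ℕ | a.degree ≤ n}.Finite := by
  classical
  refine (Set.finite_Icc (0 : σ →₀ ℕ) (Finsupp.equivFunOnFinite.symm fun _ => n)).subset ?_
  intro a ha
  refine ⟨zero_le, fun i => ?_⟩
  exact (Finsupp.le_degree i a).trans ha

/-- The number of monomials of degree at most `n` in `d` variables. -/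
noncomputable def numMonomials (d n : ℕ) : ℕ := {a : Fin d →₀ ℕ | a.degree ≤ n}.ncard

theorem pow_le_numMonomials (d n : ℕ) : (n + 1) ^ d ≤ numMonomials d ((d + 1) * n) := by
  classical
  have hcard : (Fintype.piFinset fun _ : Fin d => Finset.range (n + 1)).card = (n + 1) ^ d := by
    simp
  rw [← hcard, ← Set.ncard_coe_finset]
  refine Set.ncard_le_ncard_of_injOn (fun g => Finsupp.equivFunOnFinite.symm g) ?_
    (Finsupp.equivFunOnFinite.symm.injective.injOn) (Finsupp.finite_setOf_degree_le _ _)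
  intro g hg
  have hg' : ∀ i, g i ≤ n := fun i => by
    have := Fintype.mem_piFinset.mp hg i
    simpa [Nat.lt_succ_iff] using this
  change Finsupp.degree (Finsupp.equivFunOnFinite.symm g) ≤ _
  rw [Finsupp.degree_eq_sum]
  calc ∑ i, Finsupp.equivFunOnFinite.symm g i = ∑ i, g i := rfl
    _ ≤ ∑ _i : Fin d, n := Finset.sum_le_sum fun i _ => hg' i
    _ = d * n := by simp
    _ ≤ (d + 1) * n := Nat.mul_le_mul_right _ (Nat.le_succ d)

/-- A down-closed set of exponents all of whose members have fewer than `d` coordinates `≥ M` grows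
like a polynomial of degree at most `d - 1`. -/
theorem ncard_degree_le_of_card_lt {d e M L : ℕ} (hM : 1 ≤ M) (D : Set (Fin e →₀ ℕ))
    (hD : ∀ a ∈ D, (Finset.univ.filter fun i => M ≤ a i).card < d) :
    (L + 1) * (D ∩ {a | a.degree ≤ L}).ncard ≤ 2 ^ e * M ^ e * (L + 1) ^ d := by
  classical
  let box (T : Finset (Fin e)) : Finset (Fin e → ℕ) :=
    Fintype.piFinset fun i => if i ∈ T then Finset.range (L + 1) else Finset.range M
  let Ts : Finset (Finset (Fin e)) := Finset.univ.filter fun T => T.card < d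
  have h1 : (D ∩ {a | a.degree ≤ L}).ncard ≤ (Ts.biUnion box).card := by
    rw [← Set.ncard_coe_finset]
    refine Set.ncard_le_ncard_of_injOn (fun a => (a : Fin e → ℕ)) ?_
      (DFunLike.coe_injective.injOn) (Finset.finite_toSet _)
    rintro a ⟨haD, haL⟩
    simp only [Finset.coe_biUnion, Set.mem_iUnion, Finset.mem_coe]
    refine ⟨Finset.univ.filter fun i => M ≤ a i, by simpa [Ts] using hD a haD, ?_⟩
    refine Fintype.mem_piFinset.mpr fun i => ?_
    by_cases hi : M ≤ a i
    · simpa [hi, Nat.lt_succ_iff] using (Finsupp.le_degree i a).trans haL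
    · simpa [hi] using not_le.mp hi
  have hbox : ∀ T ∈ Ts, (L + 1) * (box T).card ≤ M ^ e * (L + 1) ^ d := by
    intro T hT
    have hT' : T.card + 1 ≤ d := by simpa [Ts] using hT
    have hle : (box T).card ≤ (L + 1) ^ T.card * M ^ e := by
      rw [Fintype.card_piFinset]
      calc ∏ i, (if i ∈ T then Finset.range (L + 1) else Finset.range M).card
          ≤ ∏ i : Fin e, ((if i ∈ T then (L + 1) else 1) * M) := by
            refine Finset.prod_le_prod' fun i _ => ?_
            split_ifs
            · rw [Finset.card_range]
              exact Nat.le_mul_of_pos_right _ hM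
            · rw [Finset.card_range, one_mul]
        _ = (L + 1) ^ T.card * M ^ e := by
            rw [Finset.prod_mul_distrib, Finset.prod_ite]
            simp
    calc (L + 1) * (box T).card ≤ (L + 1) * ((L + 1) ^ T.card * M ^ e) :=
          Nat.mul_le_mul_left _ hle
      _ = M ^ e * (L + 1) ^ (T.card + 1) := by ring
      _ ≤ M ^ e * (L + 1) ^ d :=
          Nat.mul_le_mul_left _ (Nat.pow_le_pow_right (Nat.succ_pos _) hT')
  calc (L + 1) * (D ∩ {a | a.degree ≤ L}).ncard
      ≤ (L + 1) * ∑ T ∈ Ts, (box T).card :=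
        Nat.mul_le_mul_left _ (h1.trans Finset.card_biUnion_le)
    _ = ∑ T ∈ Ts, (L + 1) * (box T).card := Finset.mul_sum ..
    _ ≤ ∑ _T ∈ Ts, M ^ e * (L + 1) ^ d := Finset.sum_le_sum hbox
    _ = Ts.card * (M ^ e * (L + 1) ^ d) := by simp
    _ ≤ 2 ^ e * (M ^ e * (L + 1) ^ d) := by
        refine Nat.mul_le_mul_right _ ((Finset.card_le_univ _).trans ?_)
        simp
    _ = _ := by ring

/-- A down-closed set of exponents that grows at least as fast as the set of all monomials in `d`
variables contains all the monomials in some `d` of the variables. -/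
theorem IsLowerSet.exists_embDomain_mem {d e : ℕ} {D : Set (Fin e →₀ ℕ)} (hD : IsLowerSet D)
    (hgrow : ∀ n, numMonomials d n ≤ (D ∩ {a | a.degree ≤ n}).ncard) :
    ∃ f : Fin d ↪ Fin e, ∀ a : Fin d →₀ ℕ, a.embDomain f ∈ D := by
  classical
  by_contra! hcon
  choose w hw using hcon
  let M := ∑ f, (w f).degree + 1
  have hwM : ∀ f i, w f i < M := fun f i =>
    Nat.lt_succ_of_le ((Finsupp.le_degree i (w f)).trans
      (Finset.single_le_sum (f := fun f => (w f).degree) (fun _ _ => Nat.zero_le _)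
        (Finset.mem_univ f)))
  have hsmall : ∀ a ∈ D, (Finset.univ.filter fun i => M ≤ a i).card < d := by
    intro a ha
    by_contra! hcard
    obtain ⟨T, hT, hTd⟩ := Finset.exists_subset_card_eq hcard
    let f : Fin d ↪ Fin e := (T.orderEmbOfFin hTd).toEmbedding
    refine hw f (hD (fun i => ?_) ha)
    by_cases hi : i ∈ Set.range f
    · obtain ⟨j, rfl⟩ := hi
      rw [Finsupp.embDomain_apply_self]
      have : f j ∈ Finset.univ.filter fun i => M ≤ a i := hT (T.orderEmbOfFin_mem hTd j)
      exact (hwM f j).le.trans (Finset.mem_filter.mp this).2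
    · rw [Finsupp.embDomain_of_notMem_range _ _ _ hi]
      exact Nat.zero_le _
  -- compare the growth rates at degree `(d + 1) * n` for `n` large
  let n := 2 ^ e * M ^ e * (d + 1) ^ d
  have h1 := ncard_degree_le_of_card_lt (L := (d + 1) * n) (Nat.le_add_left 1 _) D hsmall
  have h2 := (pow_le_numMonomials d n).trans (hgrow ((d + 1) * n))
  have h3 : ((d + 1) * n + 1) * (n + 1) ^ d ≤ n * (n + 1) ^ d := by
    calc ((d + 1) * n + 1) * (n + 1) ^ d
        ≤ 2 ^ e * M ^ e * ((d + 1) * n + 1) ^ d := (Nat.mul_le_mul_left _ h2).trans h1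
      _ ≤ 2 ^ e * M ^ e * ((d + 1) * (n + 1)) ^ d := by gcongr; nlinarith
      _ = n * (n + 1) ^ d := by rw [mul_pow, ← mul_assoc]
  have h4 := Nat.le_of_mul_le_mul_right h3 (pow_pos (Nat.succ_pos n) d)
  nlinarith

/-! ### Filtered generation -/

section Filtered

variable {R C : Type*} [CommRing R] [CommRing C] [Algebra R C]

/-- If `C = V 0 + 𝔫` and `𝔫 = V 1 + 𝔫 ^ 2` up to multiplication by elements of `U`, then
`𝔫 ^ j = V j + 𝔫 ^ (j + 1)` up to multiplication by elements of `U`. -/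
theorem exists_smul_mem_sup_pow_succ (U : Submonoid R) (𝔫 : Ideal C) (V : ℕ → Submodule R C)
    (hV : ∀ j, V j ≤ (𝔫 ^ j).restrictScalars R) (hmul : ∀ j, V j * V 1 ≤ V (j + 1))
    (h0 : ∀ c, ∃ u ∈ U, u • c ∈ V 0 ⊔ 𝔫.restrictScalars R)
    (h1 : ∀ z ∈ 𝔫, ∃ u ∈ U, u • z ∈ V 1 ⊔ (𝔫 ^ 2).restrictScalars R)
    (j : ℕ) (z : C) (hz : z ∈ 𝔫 ^ j) :
    ∃ u ∈ U, u • z ∈ V j ⊔ (𝔫 ^ (j + 1)).restrictScalars R := by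
  induction j generalizing z with
  | zero => simpa using h0 z
  | succ j ih =>
    rw [pow_succ] at hz
    induction hz using Submodule.mul_induction_on' with
    | mem_mul_mem a ha b hb =>
      obtain ⟨u₁, hu₁, h₁⟩ := ih a ha
      obtain ⟨u₂, hu₂, h₂⟩ := h1 b hb
      obtain ⟨s₁, hs₁, t₁, ht₁, e₁⟩ := Submodule.mem_sup.mp h₁
      obtain ⟨s₂, hs₂, t₂, ht₂, e₂⟩ := Submodule.mem_sup.mp h₂
      have hs₂' : s₂ ∈ 𝔫 ^ 1 := hV 1 hs₂
      have hs₁' : s₁ ∈ 𝔫 ^ j := hV j hs₁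
      simp only [Submodule.restrictScalars_mem] at ht₁ ht₂
      refine ⟨u₁ * u₂, U.mul_mem hu₁ hu₂, ?_⟩
      have : (u₁ * u₂) • (a * b) = s₁ * s₂ + (s₁ * t₂ + t₁ * s₂ + t₁ * t₂) := by
        rw [mul_smul_mul_comm, ← e₁, ← e₂]; ring
      rw [this]
      refine Submodule.add_mem_sup (hmul j (Submodule.mul_mem_mul hs₁ hs₂)) ?_
      simp only [Submodule.restrictScalars_mem]
      refine add_mem (add_mem ?_ ?_) ?_
      · have := Ideal.mul_mem_mul hs₁' ht₂
        rwa [← pow_add] at this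
      · have := Ideal.mul_mem_mul ht₁ hs₂'
        rwa [← pow_add] at this
      · have := Ideal.mul_mem_mul ht₁ ht₂
        rw [← pow_add] at this
        exact Ideal.pow_le_pow_right (by omega) this
    | add x hx y hy ihx ihy =>
      obtain ⟨u₁, hu₁, h₁⟩ := ihx
      obtain ⟨u₂, hu₂, h₂⟩ := ihy
      refine ⟨u₁ * u₂, U.mul_mem hu₁ hu₂, ?_⟩
      rw [smul_add]
      refine add_mem ?_ ?_
      · rw [mul_comm, mul_smul]; exact Submodule.smul_mem _ _ h₁
      · rw [mul_smul]; exact Submodule.smul_mem _ _ h₂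

/-- `exists_smul_mem_sup_pow_succ`, summed over the degrees from `j` to `n - 1`. -/
theorem exists_smul_mem_sup_pow (U : Submonoid R) (𝔫 : Ideal C) (V : ℕ → Submodule R C)
    (hV : ∀ j, V j ≤ (𝔫 ^ j).restrictScalars R) (hmul : ∀ j, V j * V 1 ≤ V (j + 1))
    (h0 : ∀ c, ∃ u ∈ U, u • c ∈ V 0 ⊔ 𝔫.restrictScalars R)
    (h1 : ∀ z ∈ 𝔫, ∃ u ∈ U, u • z ∈ V 1 ⊔ (𝔫 ^ 2).restrictScalars R)
    {W : Submodule R C} {j n : ℕ} (hW : ∀ i, j ≤ i → i < n → V i ≤ W)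
    {z : C} (hz : z ∈ 𝔫 ^ j) :
    ∃ u ∈ U, u • z ∈ W ⊔ (𝔫 ^ n).restrictScalars R := by
  obtain h | h := le_total n j
  · exact ⟨1, U.one_mem, Submodule.mem_sup_right (by simpa using Ideal.pow_le_pow_right h hz)⟩
  induction h using Nat.decreasingInduction generalizing z with
  | self => exact ⟨1, U.one_mem, Submodule.mem_sup_right (by simpa using hz)⟩
  | of_succ j hj ih =>
    obtain ⟨u, hu, h⟩ := exists_smul_mem_sup_pow_succ U 𝔫 V hV hmul h0 h1 j z hz
    obtain ⟨s, hs, t, ht, e⟩ := Submodule.mem_sup.mp h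
    obtain ⟨v, hv, h'⟩ := ih (fun i hi => hW i (Nat.le_of_succ_le hi)) ht
    refine ⟨v * u, U.mul_mem hv hu, ?_⟩
    rw [mul_smul, ← e, smul_add]
    exact add_mem (Submodule.mem_sup_left (W.smul_mem _ (hW j le_rfl hj hs))) h'

/-- The monomial with exponent `a` in the elements `y i`. -/
noncomputable def mon {σ : Type*} (y : σ → C) (a : σ →₀ ℕ) : C := a.prod fun i k => y i ^ k

@[simp]
theorem mon_zero {σ : Type*} (y : σ → C) : mon y 0 = 1 := by simp [mon]

theorem mon_add {σ : Type*} (y : σ → C) (a b : σ →₀ ℕ) : mon y (a + b) = mon y a * mon y b := by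
  classical
  exact Finsupp.prod_add_index' (by simp) (by simp [pow_add])

@[simp]
theorem mon_single {σ : Type*} (y : σ → C) (i : σ) : mon y (Finsupp.single i 1) = y i := by
  simp [mon]

theorem map_mon {σ B : Type*} [CommRing B] (f : C →+* B) (y : σ → C) (a : σ →₀ ℕ) :
    f (mon y a) = mon (fun i => f (y i)) a := by
  simp [mon, Finsupp.prod, map_prod]

theorem mon_mem_pow {σ : Type*} {y : σ → C} {𝔫 : Ideal C} (hy : ∀ i, y i ∈ 𝔫) (a : σ →₀ ℕ) :
    mon y a ∈ 𝔫 ^ a.degree := by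
  classical
  rw [Finsupp.degree_apply, mon, Finsupp.prod, ← Finset.prod_pow_eq_pow_sum]
  exact Ideal.prod_mem_prod fun i _ => Ideal.pow_mem_pow (hy i) _

/-- An algebra `C = R + 𝔫` with `𝔫` generated by the `y i` modulo `𝔫 ^ 2` is spanned modulo
`𝔫 ^ (n + 1)` by the monomials of degree at most `n` in the `y i`; everything is up to
multiplication by elements of a multiplicative set `U`. -/
theorem exists_smul_mem_span_mon {σ : Type*} (U : Submonoid R) {𝔫 : Ideal C} {y : σ → C}
    (hy : ∀ i, y i ∈ 𝔫) (h0 : ∀ c, ∃ r : R, c - algebraMap R C r ∈ 𝔫)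
    (h1 : ∀ z ∈ 𝔫, ∃ u ∈ U,
      u • z ∈ Submodule.span R (Set.range y) ⊔ (𝔫 ^ 2).restrictScalars R)
    {j n : ℕ} {z : C} (hz : z ∈ 𝔫 ^ j) :
    ∃ u ∈ U, u • z ∈ Submodule.span R (mon y '' {b | j ≤ b.degree ∧ b.degree ≤ n}) ⊔
      (𝔫 ^ (n + 1)).restrictScalars R := by
  classical
  refine exists_smul_mem_sup_pow U 𝔫 (fun j => Submodule.span R (mon y '' {b | b.degree = j}))
    ?_ ?_ ?_ ?_ ?_ hz
  · intro j
    rw [Submodule.span_le]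
    rintro _ ⟨b, rfl, rfl⟩
    exact mon_mem_pow hy b
  · intro j
    rw [Submodule.span_mul_span, Submodule.span_le]
    rintro _ ⟨_, ⟨b, rfl, rfl⟩, _, ⟨c, hc, rfl⟩, rfl⟩
    refine Submodule.subset_span ⟨b + c, ?_, mon_add y b c⟩
    simp only [Set.mem_ofPred_eq] at hc
    simp [map_add, hc]
  · intro c
    obtain ⟨r, hr⟩ := h0 c
    refine ⟨1, U.one_mem, ?_⟩
    rw [one_smul, ← add_sub_cancel (algebraMap R C r) c]
    refine Submodule.add_mem_sup ?_ hr
    rw [Algebra.algebraMap_eq_smul_one]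
    exact Submodule.smul_mem _ _ (Submodule.subset_span ⟨0, by simp, by simp⟩)
  · intro z hz
    obtain ⟨u, hu, h⟩ := h1 z hz
    have hle : Submodule.span R (Set.range y) ≤
        Submodule.span R (mon y '' {b | b.degree = 1}) := by
      refine Submodule.span_mono ?_
      rintro _ ⟨i, rfl⟩
      exact ⟨Finsupp.single i 1, by simp, by simp⟩
    exact ⟨u, hu, (sup_le_sup_right hle _ : _ ≤ _) h⟩
  · intro i hi hin
    refine Submodule.span_mono (Set.image_mono ?_)
    rintro b rfl
    exact ⟨hi, Nat.lt_succ_iff.mp hin⟩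

end Filtered

/-! ### Standard monomials -/

section Standard

variable {R A : Type*} [CommRing R] [CommRing A] [Algebra R A] {e : ℕ}

/-- The exponents `a` of the standard monomials of an `R`-algebra `A` with respect to an ideal `𝔫`
and elements `y i`: those for which `y ^ a` is not, modulo `𝔫 ^ (|a| + 1)`, a combination of
monomials that are larger in the degree-lexicographic order. -/
def standardExponents (R : Type*) {A : Type*} [CommRing R] [CommRing A] [Algebra R A] {e : ℕ}
    (𝔫 : Ideal A) (y : Fin e → A) : Set (Fin e →₀ ℕ) :=
  {a | mon y a ∉ Submodule.span R (mon y '' {b | toDegLex a < toDegLex b}) ⊔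
    (𝔫 ^ (a.degree + 1)).restrictScalars R}

theorem isLowerSet_standardExponents {𝔫 : Ideal A} {y : Fin e → A} (hy : ∀ i, y i ∈ 𝔫) :
    IsLowerSet (standardExponents R 𝔫 y) := by
  intro a b hba ha hb
  refine ha ?_
  obtain ⟨c, rfl⟩ := exists_add_of_le hba
  obtain ⟨s, hs, t, ht, e⟩ := Submodule.mem_sup.mp hb
  rw [mon_add, ← e, add_mul]
  refine Submodule.add_mem_sup ?_ ?_
  · have h1 : s * mon y c ∈ Submodule.span R (mon y '' {d | toDegLex b < toDegLex d}) *
        Submodule.span R {mon y c} :=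
      Submodule.mul_mem_mul hs (Submodule.mem_span_singleton_self _)
    rw [Submodule.span_mul_span] at h1
    refine Submodule.span_mono ?_ h1
    rintro _ ⟨_, ⟨d, hd, rfl⟩, _, rfl, rfl⟩
    refine ⟨d + c, ?_, mon_add y d c⟩
    simp only [Set.mem_ofPred_eq] at hd ⊢
    rw [toDegLex_add, toDegLex_add]
    exact add_lt_add_left hd _
  · have h1 := Ideal.mul_mem_mul ht (mon_mem_pow hy c)
    rw [← pow_add] at h1
    rw [map_add]
    exact Ideal.pow_le_pow_right (by omega) h1

/-- The standard monomials of degree at most `n` span `A` modulo `𝔫 ^ (n + 1)`. -/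
theorem span_standardExponents_sup_pow {𝔫 : Ideal A} {y : Fin e → A} (hy : ∀ i, y i ∈ 𝔫)
    (h0 : ∀ c, ∃ r : R, c - algebraMap R A r ∈ 𝔫)
    (h1 : 𝔫.restrictScalars R ≤ Submodule.span R (Set.range y) ⊔ (𝔫 ^ 2).restrictScalars R)
    (n : ℕ) :
    Submodule.span R (mon y '' (standardExponents R 𝔫 y ∩ {a | a.degree ≤ n})) ⊔
      (𝔫 ^ (n + 1)).restrictScalars R = ⊤ := by
  classical
  set N := Submodule.span R (mon y '' (standardExponents R 𝔫 y ∩ {a | a.degree ≤ n})) ⊔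
      (𝔫 ^ (n + 1)).restrictScalars R with hN
  have hspan : ∀ j, ∀ z ∈ 𝔫 ^ j,
      z ∈ Submodule.span R (mon y '' {b | j ≤ b.degree ∧ b.degree ≤ n}) ⊔
        (𝔫 ^ (n + 1)).restrictScalars R := by
    intro j z hz
    obtain ⟨u, hu, h⟩ := exists_smul_mem_span_mon (R := R) ⊥ hy h0
      (fun z hz => ⟨1, rfl, by simpa using h1 hz⟩) (n := n) hz
    rw [Submonoid.mem_bot.mp hu, one_smul] at h
    exact h
  have key : ∀ a, mon y a ∈ N := by
    by_contra! hbad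
    have hfin : (toDegLex '' {a | mon y a ∉ N}).Finite := by
      refine Set.Finite.image _ ((Finsupp.finite_setOf_degree_le _ n).subset ?_)
      intro a ha
      by_contra hdeg
      refine ha (Submodule.mem_sup_right ?_)
      exact Ideal.pow_le_pow_right (by simp at hdeg; omega) (mon_mem_pow hy a)
    -- a monomial outside `N` that is maximal for the order
    obtain ⟨_, ⟨a, ha, rfl⟩, hmax⟩ := Set.exists_max_image _ id hfin (Set.Nonempty.image _ hbad)
    have hgt : ∀ b, toDegLex a < toDegLex b → mon y b ∈ N := by
      intro b hb
      by_contra hbN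
      exact absurd (hmax _ ⟨b, hbN, rfl⟩) (not_le.mpr hb)
    have hdeg : a.degree ≤ n := by
      by_contra hdeg
      refine ha (Submodule.mem_sup_right ?_)
      exact Ideal.pow_le_pow_right (by omega) (mon_mem_pow hy a)
    by_cases hB : a ∈ standardExponents R 𝔫 y
    · exact ha (Submodule.mem_sup_left (Submodule.subset_span ⟨a, ⟨hB, hdeg⟩, rfl⟩))
    · refine ha ((?_ : _ ≤ N) (not_not.mp hB))
      refine sup_le (Submodule.span_le.mpr ?_) fun z hz => ?_
      · rintro _ ⟨b, hb, rfl⟩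
        exact hgt b hb
      · refine (sup_le (Submodule.span_le.mpr ?_) le_sup_right : _ ≤ N) (hspan _ z hz)
        rintro _ ⟨b, hb, rfl⟩
        refine hgt b (Finsupp.DegLex.lt_iff.mpr (Or.inl ?_))
        exact Nat.lt_of_succ_le hb.1
  rw [eq_top_iff]
  intro z _
  refine (sup_le (Submodule.span_le.mpr ?_) le_sup_right : _ ≤ N) (hspan 0 z (by simp))
  rintro _ ⟨b, -, rfl⟩
  exact key b

/-- The standard monomials of degree at most `n` are independent modulo `𝔫 ^ (n + 1)` over the
residue field of a maximal ideal `m` that annihilates `A`. -/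
theorem mem_of_sum_smul_mon_mem_pow {m : Ideal R} (hm : m.IsMaximal)
    (hmA : ∀ r ∈ m, algebraMap R A r = 0) {𝔫 : Ideal A} {y : Fin e → A} {n : ℕ}
    {s : Finset (Fin e →₀ ℕ)} (hs : ∀ a ∈ s, a ∈ standardExponents R 𝔫 y ∧ a.degree ≤ n)
    (c : (Fin e →₀ ℕ) → R) (hc : ∑ a ∈ s, c a • mon y a ∈ 𝔫 ^ (n + 1)) :
    ∀ a ∈ s, c a ∈ m := by
  classical
  by_contra! hbad
  let t := s.filter fun a => c a ∉ m
  have ht : (t.image toDegLex).Nonempty := by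
    obtain ⟨a, ha, hca⟩ := hbad
    exact ⟨_, Finset.mem_image_of_mem _ (Finset.mem_filter.mpr ⟨ha, hca⟩)⟩
  obtain ⟨_, hat', hmin⟩ := Finset.exists_min_image _ id ht
  obtain ⟨a, hat, rfl⟩ := Finset.mem_image.mp hat'
  have has := (Finset.mem_filter.mp hat).1
  have hca := (Finset.mem_filter.mp hat).2
  obtain ⟨hB, hdeg⟩ := hs a has
  refine hB ?_
  set W := Submodule.span R (mon y '' {b | toDegLex a < toDegLex b}) ⊔
    (𝔫 ^ (a.degree + 1)).restrictScalars R
  have hrest : ∑ b ∈ s.erase a, c b • mon y b ∈ W := by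
    refine Submodule.sum_mem _ fun b hb => ?_
    by_cases hcb : c b ∈ m
    · rw [Algebra.smul_def, hmA _ hcb, zero_mul]
      exact W.zero_mem
    · refine W.smul_mem _ (Submodule.mem_sup_left (Submodule.subset_span ⟨b, ?_, rfl⟩))
      refine lt_of_le_of_ne (hmin _ (Finset.mem_image_of_mem _
        (Finset.mem_filter.mpr ⟨Finset.mem_of_mem_erase hb, hcb⟩))) ?_
      exact fun h => Finset.ne_of_mem_erase hb (toDegLex_injective h).symm
  have hca' : c a • mon y a ∈ W := by
    rw [← Finset.add_sum_erase s _ has] at hc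
    have h1 : c a • mon y a + ∑ b ∈ s.erase a, c b • mon y b ∈ W :=
      Submodule.mem_sup_right (Ideal.pow_le_pow_right (Nat.succ_le_succ hdeg) hc)
    simpa using W.sub_mem h1 hrest
  -- `c a` is invertible modulo `m`
  obtain ⟨r, k, hk, hr⟩ := hm.exists_inv hca
  have : mon y a = r • c a • mon y a := by
    have hk' : k • mon y a = 0 := by rw [Algebra.smul_def, hmA _ hk, zero_mul]
    rw [smul_smul, ← add_zero ((r * c a) • mon y a), ← hk', ← add_smul, hr, one_smul]
  rw [this]
  exact W.smul_mem _ hca'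

theorem Finsupp.exists_eq_single_of_degree_eq_one {σ : Type*} {b : σ →₀ ℕ} (hb : b.degree = 1) :
    ∃ j, b = Finsupp.single j 1 := by
  classical
  obtain ⟨j, hj⟩ : ∃ j, b j ≠ 0 := by
    by_contra! h0
    rw [Finsupp.ext (f := b) (g := 0) h0] at hb
    simp at hb
  obtain ⟨c, rfl⟩ := exists_add_of_le
    (Finsupp.single_le_iff.mpr (Nat.one_le_iff_ne_zero.mpr hj) : Finsupp.single j 1 ≤ b)
  rw [map_add, Finsupp.degree_single, Nat.add_eq_left, Finsupp.degree_eq_zero_iff] at hb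
  exact ⟨j, by rw [hb, add_zero]⟩

/-- Let `A` be an algebra over a field `R ⧸ m` with an ideal `𝔫` of codimension one, minimally
generated by `e` elements modulo `𝔫 ^ 2`. If the lengths of all quotients `A ⧸ 𝔫 ^ (n + 1)` are at
least those for a polynomial ring in `d` variables, and for one `N ≥ 1` also at most that, then
`e ≤ d`. Indeed, the first hypothesis makes all monomials in some `d` of the generators standard;
if there were a further generator, it would be one standard monomial too many for the second. -/
theorem le_of_numMonomials_le {m : Ideal R} (hm : m.IsMaximal)
    (hmA : ∀ r ∈ m, algebraMap R A r = 0) {𝔫 : Ideal A} {y : Fin e → A} (hy : ∀ i, y i ∈ 𝔫)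
    (h0 : ∀ c, ∃ r : R, c - algebraMap R A r ∈ 𝔫)
    (h1 : 𝔫.restrictScalars R ≤ Submodule.span R (Set.range y) ⊔ (𝔫 ^ 2).restrictScalars R)
    (hind : ∀ c : Fin e → R, ∑ i, c i • y i ∈ 𝔫 ^ 2 → ∀ i, c i ∈ m) {d N : ℕ} (hN : 1 ≤ N)
    (hlow : ∀ n, ∀ T : Finset A,
      Submodule.span R (T : Set A) ⊔ (𝔫 ^ (n + 1)).restrictScalars R = ⊤ →
        numMonomials d n ≤ T.card)
    (hup : ∀ (k : ℕ) (v : Fin k → A),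
      (∀ c : Fin k → R, ∑ i, c i • v i ∈ 𝔫 ^ (N + 1) → ∀ i, c i ∈ m) → k ≤ numMonomials d N) :
    e ≤ d := by
  classical
  have hfin : ∀ n, (standardExponents R 𝔫 y ∩ {a | a.degree ≤ n}).Finite := fun n =>
    (Finsupp.finite_setOf_degree_le _ n).subset Set.inter_subset_right
  obtain ⟨f, hf⟩ := (isLowerSet_standardExponents (R := R) hy).exists_embDomain_mem (d := d) <| by
    intro n
    rw [Set.ncard_eq_toFinset_card _ (hfin n)]
    refine (hlow n ((hfin n).toFinset.image (mon y)) ?_).trans Finset.card_image_le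
    rw [Finset.coe_image, Set.Finite.coe_toFinset]
    exact span_standardExponents_sup_pow hy h0 h1 n
  by_contra! hde
  -- a variable that does not occur in the monomials provided by `f`
  obtain ⟨i, hi⟩ : ∃ i, i ∉ Set.range f := by
    by_contra! hsurj
    have := Fintype.card_le_of_surjective f hsurj
    simp at this
    omega
  have hiB : Finsupp.single i 1 ∈ standardExponents R 𝔫 y := by
    intro hmem
    rw [mon_single, Finsupp.degree_single] at hmem
    have hle : Submodule.span R (mon y '' {b | toDegLex (Finsupp.single i 1) < toDegLex b}) ⊔
        (𝔫 ^ (1 + 1)).restrictScalars R ≤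
        Submodule.span R (y '' {j | j ≠ i}) ⊔ (𝔫 ^ 2).restrictScalars R := by
      refine sup_le (Submodule.span_le.mpr ?_) le_sup_right
      rintro _ ⟨b, hb, rfl⟩
      have hb' : toDegLex (Finsupp.single i 1) < toDegLex b := hb
      have hdeg := Finsupp.DegLex.monotone_degree hb'.le
      simp only [ofDegLex_toDegLex, Finsupp.degree_single] at hdeg
      obtain hdeg | hdeg := hdeg.eq_or_lt
      · obtain ⟨j, rfl⟩ := Finsupp.exists_eq_single_of_degree_eq_one hdeg.symm
        refine Submodule.mem_sup_left (Submodule.subset_span ⟨j, ?_, by simp⟩)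
        rintro rfl
        exact lt_irrefl _ hb'
      · exact Submodule.mem_sup_right (Ideal.pow_le_pow_right hdeg (mon_mem_pow hy b))
    obtain ⟨s, hs, t, ht, est⟩ := Submodule.mem_sup.mp (hle hmem)
    rw [Set.image_eq_range] at hs
    obtain ⟨c, hc⟩ := (Submodule.mem_span_range_iff_exists_fun R).mp hs
    have h2 := hind (fun j => if h : j ≠ i then - c ⟨j, h⟩ else 1) ?_ i
    · exact hm.ne_top ((Ideal.eq_top_iff_one _).mpr (by simpa using h2))
    · have : ∑ j, (if h : j ≠ i then - c ⟨j, h⟩ else 1) • y j = t := by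
        rw [← Finset.add_sum_erase _ _ (Finset.mem_univ i)]
        have e1 : ∑ j ∈ Finset.univ.erase i, (if h : j ≠ i then - c ⟨j, h⟩ else 1) • y j
            = - s := by
          rw [← hc, ← Finset.sum_neg_distrib]
          rw [Finset.sum_subtype (p := fun j => j ∈ {j | j ≠ i}) (Finset.univ.erase i)
            (by simp)]
          refine Finset.sum_congr rfl fun j _ => ?_
          have hj : (j : Fin e) ≠ i := j.2
          simp [hj]
        rw [e1]
        simp [← est]
      rw [this]
      exact ht
  -- the monomials provided by `f` together with that variable are too many
  let s : Set (Fin e →₀ ℕ) :=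
    insert (Finsupp.single i 1) (Finsupp.embDomain f '' {a : Fin d →₀ ℕ | a.degree ≤ N})
  have hsfin : s.Finite := ((Finsupp.finite_setOf_degree_le _ N).image _).insert _
  have hscard : s.ncard = numMonomials d N + 1 := by
    rw [Set.ncard_insert_of_notMem _ ((Finsupp.finite_setOf_degree_le _ N).image _),
      Set.ncard_image_of_injective _ (Finsupp.embDomain_injective f)]
    · rfl
    · rintro ⟨a, -, ha⟩
      have := DFunLike.congr_fun ha i
      rw [Finsupp.embDomain_of_notMem_range _ _ _ hi] at this
      simp at this
  have hsB : ∀ a ∈ hsfin.toFinset, a ∈ standardExponents R 𝔫 y ∧ a.degree ≤ N := by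
    intro a ha
    rw [Set.Finite.mem_toFinset] at ha
    obtain rfl | ⟨b, hb, rfl⟩ := ha
    · exact ⟨hiB, by simpa using hN⟩
    · refine ⟨hf b, ?_⟩
      rw [Finsupp.degree_apply, Finsupp.support_embDomain, Finset.sum_map]
      simpa [Finsupp.degree_apply] using hb
  have hk : hsfin.toFinset.card = numMonomials d N + 1 := by
    rw [← hscard, Set.ncard_eq_toFinset_card _ hsfin]
  let ε := hsfin.toFinset.equivFin.symm
  have := hup _ (fun j => mon y (ε j)) fun c hc j => by
    let c' : (Fin e →₀ ℕ) → R := fun a =>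
      if h : a ∈ hsfin.toFinset then c (ε.symm ⟨a, h⟩) else 0
    have h3 := mem_of_sum_smul_mon_mem_pow hm hmA hsB c' ?_ (ε j) (ε j).2
    · simpa only [c', Finset.coe_mem, dite_true, Subtype.coe_eta, Equiv.symm_apply_apply] using h3
    · convert hc using 1
      rw [← Finset.sum_coe_sort, ← Equiv.sum_comp ε]
      exact Finset.sum_congr rfl fun j _ => by
        simp only [c', Finset.coe_mem, dite_true, Subtype.coe_eta, Equiv.symm_apply_apply]
  omega

end Standard

/-! ### Principal parts of a formally smooth algebra -/

section Diff

variable (K : Type*) {R : Type*} [CommRing K] [CommRing R] [Algebra K R]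

/-- The element `1 ⊗ x - x ⊗ 1` of `R ⊗[K] R`, whose class in `Ω[R⁄K]` is the differential of
`x`. -/
def diffTensor (x : R) : R ⊗[K] R := 1 ⊗ₜ[K] x - x ⊗ₜ[K] 1

theorem diffTensor_mem (x : R) : diffTensor K x ∈ KaehlerDifferential.ideal K R :=
  KaehlerDifferential.one_smul_sub_smul_one_mem_ideal K x

theorem exists_sub_algebraMap_mem_ideal (c : R ⊗[K] R) :
    ∃ r : R, c - algebraMap R (R ⊗[K] R) r ∈ KaehlerDifferential.ideal K R := by
  refine ⟨Algebra.TensorProduct.lmul' K c, ?_⟩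
  rw [RingHom.mem_ker, map_sub, sub_eq_zero]
  simp

end Diff

/-- Ideal generators of `𝔫` in an algebra `C = R + 𝔫` span `𝔫` over `R` modulo `𝔫 ^ 2`. -/
theorem restrictScalars_le_span_sup_sq {R C : Type*} [CommRing R] [CommRing C] [Algebra R C]
    {ι : Type*} {𝔫 : Ideal C} {y : ι → C}
    (h0 : ∀ c, ∃ r : R, c - algebraMap R C r ∈ 𝔫) (h : Ideal.span (Set.range y) = 𝔫) :
    𝔫.restrictScalars R ≤ Submodule.span R (Set.range y) ⊔ (𝔫 ^ 2).restrictScalars R := by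
  intro z hz
  have hz' : z ∈ Ideal.span (Set.range y) := by rw [h]; exact hz
  induction hz' using Submodule.span_induction with
  | mem x hx => exact Submodule.mem_sup_left (Submodule.subset_span hx)
  | zero => exact zero_mem _
  | add a b ha hb iha ihb => exact add_mem (iha (h ▸ ha)) (ihb (h ▸ hb))
  | smul a b hb ih =>
    have hb' : b ∈ 𝔫 := h ▸ hb
    obtain ⟨r, hr⟩ := h0 a
    have : a • b = r • b + (a - algebraMap R C r) * b := by
      rw [Algebra.smul_def r, smul_eq_mul]; ring
    rw [this]
    refine add_mem (Submodule.smul_mem _ _ (ih hb')) (Submodule.mem_sup_right ?_)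
    rw [pow_two]
    exact Ideal.mul_mem_mul hr hb'

/-- Let `F` be formally smooth over `K` with the `D (x i)` a basis of `Ω[F⁄K]`, and let `B` be an
`F`-algebra with the properties of the truncated polynomial ring `F[T] ⧸ (T) ^ (n + 1)`. The first
order Taylor expansion `F → B ⧸ (T) ^ 2` lifts to `B`, and the resulting map from the principal
parts to `B` sends the monomials in the `1 ⊗ x i - x i ⊗ 1` to a system of as many generators as the
rank. -/
theorem eq_zero_of_sum_smul_mon_diffTensor_mem_of_truncated {K F B : Type*} [CommRing K]
    [CommRing F] [Algebra K F] [CommRing B] [Algebra K B] [Algebra F B] [IsScalarTower K F B]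
    [Algebra.FormallySmooth K F] {d : ℕ} (b : Module.Basis (Fin d) F Ω[F⁄K])
    (x : Fin d → F) (hb : ∀ i, b i = KaehlerDifferential.D K F (x i)) (n : ℕ)
    {𝔫 : Ideal B} {T : Fin d → B} (hpow : 𝔫 ^ (n + 1) = ⊥) (hspan : Ideal.span (Set.range T) = 𝔫)
    (h0 : ∀ z : B, ∃ r : F, z - algebraMap F B r ∈ 𝔫)
    (hinj : LinearIndependent F fun a : {a : Fin d →₀ ℕ // a.degree ≤ n} => mon T a.1)
    (c : {a : Fin d →₀ ℕ // a.degree ≤ n} →₀ F)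
    (hc : c.sum (fun a r => r • mon (fun i => diffTensor K (x i)) a.1) ∈
      KaehlerDifferential.ideal K F ^ (n + 1)) : c = 0 := by
  classical
  have : Finite {a : Fin d →₀ ℕ // a.degree ≤ n} := Finsupp.finite_setOf_degree_le _ n
  have hT : ∀ i, T i ∈ 𝔫 := fun i => hspan ▸ Ideal.subset_span ⟨i, rfl⟩
  have h1 := restrictScalars_le_span_sup_sq h0 hspan
  -- the first order Taylor expansion
  let L : F →ₗ[K] B := (Algebra.linearMap F B).restrictScalars K +
    ∑ i, ((LinearMap.toSpanSingleton F B (T i)).restrictScalars K) ∘ₗ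
      ((b.coord i).restrictScalars K) ∘ₗ (KaehlerDifferential.D K F : F →ₗ[K] Ω[F⁄K])
  have hL : ∀ f, L f = algebraMap F B f +
      ∑ i, b.coord i (KaehlerDifferential.D K F f) • T i := by
    intro f
    simp [L, LinearMap.sum_apply]
  have hL𝔫 : ∀ f, L f - algebraMap F B f ∈ 𝔫 := by
    intro f
    rw [hL, add_sub_cancel_left]
    refine Submodule.sum_mem _ fun i _ => ?_
    rw [Algebra.smul_def]
    exact 𝔫.mul_mem_left _ (hT i)
  let g : F →ₐ[K] B ⧸ 𝔫 ^ 2 := AlgHom.ofLinearMap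
    ((Ideal.Quotient.mkₐ K (𝔫 ^ 2)).toLinearMap ∘ₗ L)
    (by
      have : L 1 = 1 := by rw [hL]; simp
      simp [this])
    (by
      intro f f'
      change Ideal.Quotient.mk (𝔫 ^ 2) (L (f * f')) =
        Ideal.Quotient.mk (𝔫 ^ 2) (L f) * Ideal.Quotient.mk (𝔫 ^ 2) (L f')
      rw [← map_mul, Ideal.Quotient.eq]
      have h2 : L (f * f') - L f * L f' =
          - ((L f - algebraMap F B f) * (L f' - algebraMap F B f')) := by
        have h3 : ∑ i, b.coord i (KaehlerDifferential.D K F (f * f')) • T i =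
            algebraMap F B f * ∑ i, b.coord i (KaehlerDifferential.D K F f') • T i +
            algebraMap F B f' * ∑ i, b.coord i (KaehlerDifferential.D K F f) • T i := by
          rw [Finset.mul_sum, Finset.mul_sum, ← Finset.sum_add_distrib]
          refine Finset.sum_congr rfl fun i _ => ?_
          rw [Derivation.leibniz, map_add, map_smul, map_smul]
          simp only [Algebra.smul_def, map_add, map_mul, Algebra.algebraMap_self,
            RingHom.id_apply]
          ring
        rw [hL, hL, hL, h3, map_mul]
        ring
      rw [h2, pow_two]
      exact neg_mem (Ideal.mul_mem_mul (hL𝔫 f) (hL𝔫 f')))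
  have hnil : IsNilpotent (𝔫 ^ 2) := ⟨n + 1, by
    rw [← pow_mul, mul_comm, pow_mul, hpow]
    exact Ideal.bot_pow two_ne_zero⟩
  let φ : F →ₐ[K] B := Algebra.FormallySmooth.lift (𝔫 ^ 2) hnil g
  have hφ : ∀ f, φ f - L f ∈ 𝔫 ^ 2 := fun f => by
    rw [← Ideal.Quotient.eq]
    exact Algebra.FormallySmooth.mk_lift (𝔫 ^ 2) hnil g f
  let ψ : F ⊗[K] F →ₐ[F] B :=
    Algebra.TensorProduct.lift (Algebra.ofId F B) φ fun _ _ => Commute.all _ _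
  have hψ : ∀ f, ψ (diffTensor K f) = φ f - algebraMap F B f := fun f => by
    simp [ψ, diffTensor, Algebra.ofId_apply]
  have hψ𝔫 : ∀ f, ψ (diffTensor K f) ∈ 𝔫 := fun f => by
    rw [hψ, ← sub_add_sub_cancel (φ f) (L f)]
    exact add_mem (Ideal.pow_le_self two_ne_zero (hφ f)) (hL𝔫 f)
  have hψT : ∀ i, T i - ψ (diffTensor K (x i)) ∈ 𝔫 ^ 2 := fun i => by
    have h3 : T i = L (x i) - algebraMap F B (x i) := by
      rw [hL, add_sub_cancel_left]
      simp [← hb, Finsupp.single_apply]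
    rw [hψ, h3, sub_sub_sub_cancel_right, ← neg_sub]
    exact neg_mem (hφ _)
  have hψΔ : KaehlerDifferential.ideal K F ≤ 𝔫.comap (ψ : F ⊗[K] F →+* B) := by
    rw [← KaehlerDifferential.span_range_eq_ideal, Ideal.span_le]
    rintro _ ⟨f, rfl⟩
    exact hψ𝔫 f
  have h1' : 𝔫.restrictScalars F ≤ Submodule.span F (Set.range fun i => ψ (diffTensor K (x i))) ⊔
      (𝔫 ^ 2).restrictScalars F := by
    refine h1.trans (sup_le (Submodule.span_le.mpr ?_) le_sup_right)
    rintro _ ⟨i, rfl⟩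
    rw [SetLike.mem_coe, ← add_sub_cancel (ψ (diffTensor K (x i))) (T i)]
    exact Submodule.add_mem_sup (Submodule.subset_span ⟨i, rfl⟩) (hψT i)
  -- both systems of monomials generate `B`, and the standard one is independent
  have hsurj : ∀ y : Fin d → B, (∀ i, y i ∈ 𝔫) → 𝔫.restrictScalars F ≤
      Submodule.span F (Set.range y) ⊔ (𝔫 ^ 2).restrictScalars F →
      Function.Surjective (Finsupp.linearCombination F
        fun a : {a : Fin d →₀ ℕ // a.degree ≤ n} => mon y a.1) := by
    intro y hy hy1
    rw [← LinearMap.range_eq_top, Finsupp.range_linearCombination, eq_top_iff]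
    intro z _
    obtain ⟨u, hu, h⟩ := exists_smul_mem_span_mon (R := F) ⊥ hy h0
      (fun z hz => ⟨1, rfl, by simpa using hy1 hz⟩) (j := 0) (n := n) (z := z) (by simp)
    rw [Submonoid.mem_bot.mp hu, one_smul, hpow] at h
    have hbot : (⊥ : Ideal B).restrictScalars F = ⊥ := rfl
    rw [hbot, sup_bot_eq] at h
    refine Submodule.span_mono ?_ h
    rintro _ ⟨a, ha, rfl⟩
    exact ⟨⟨a, ha.2⟩, rfl⟩
  let Λ₀ := LinearEquiv.ofBijective _ ⟨hinj, hsurj T hT h1⟩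
  let Λ := Finsupp.linearCombination F
    fun a : {a : Fin d →₀ ℕ // a.degree ≤ n} => mon (fun i => ψ (diffTensor K (x i))) a.1
  have hΛ : Function.Injective (Λ₀.symm.toLinearMap ∘ₗ Λ) :=
    OrzechProperty.injective_of_surjective_endomorphism _
      (Λ₀.symm.surjective.comp (hsurj _ (fun i => hψ𝔫 _) h1'))
  have hΛc : Λ c = 0 := by
    have h2 := Ideal.pow_right_mono hψΔ (n + 1) hc
    have h3 : ψ (c.sum fun a r => r • mon (fun i => diffTensor K (x i)) a.1) ∈ 𝔫 ^ (n + 1) :=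
      Ideal.le_comap_pow _ _ h2
    rw [hpow, Ideal.mem_bot] at h3
    rw [← h3, Finsupp.linearCombination_apply, map_finsuppSum]
    refine Finsupp.sum_congr fun a _ => ?_
    rw [map_smul]
    congr 1
    exact (map_mon (ψ : F ⊗[K] F →+* B) _ _).symm
  exact hΛ (by simp [hΛc])

/-- If `F` is formally smooth over `K` and the `D (x i)` form a basis of `Ω[F⁄K]`, then the
monomials of degree at most `n` in the elements `1 ⊗ x i - x i ⊗ 1` are linearly independent in the
module of principal parts of order `n`. -/
theorem eq_zero_of_sum_smul_mon_diffTensor_mem {K F : Type*} [CommRing K] [CommRing F]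
    [Algebra K F] [Algebra.FormallySmooth K F] {d : ℕ} (b : Module.Basis (Fin d) F Ω[F⁄K])
    (x : Fin d → F) (hb : ∀ i, b i = KaehlerDifferential.D K F (x i)) (n : ℕ)
    (c : {a : Fin d →₀ ℕ // a.degree ≤ n} →₀ F)
    (hc : c.sum (fun a r => r • mon (fun i => diffTensor K (x i)) a.1) ∈
      KaehlerDifferential.ideal K F ^ (n + 1)) : c = 0 := by
  classical
  let 𝔱 := MvPolynomial.idealOfVars (Fin d) F
  let π : MvPolynomial (Fin d) F →ₐ[F] MvPolynomial (Fin d) F ⧸ 𝔱 ^ (n + 1) :=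
    Ideal.Quotient.mkₐ F _
  have hπ : Function.Surjective π := Ideal.Quotient.mk_surjective
  refine eq_zero_of_sum_smul_mon_diffTensor_mem_of_truncated b x hb n
    (𝔫 := 𝔱.map π) (T := fun i => π (MvPolynomial.X i)) ?_ ?_ ?_ ?_ c hc
  · rw [← Ideal.map_pow]
    exact Ideal.map_quotient_self _
  · simp only [𝔱, MvPolynomial.idealOfVars, Ideal.map_span, ← Set.range_comp]
    rfl
  · intro z
    obtain ⟨p, rfl⟩ := hπ z
    induction p using MvPolynomial.induction_on with
    | C a =>
      refine ⟨a, ?_⟩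
      rw [← AlgHom.commutes π, MvPolynomial.algebraMap_eq, sub_self]
      exact zero_mem _
    | add p q hp hq =>
      obtain ⟨r, hr⟩ := hp
      obtain ⟨s, hs⟩ := hq
      exact ⟨r + s, by simpa [add_sub_add_comm] using add_mem hr hs⟩
    | mul_X p i hp =>
      refine ⟨0, ?_⟩
      rw [map_zero, sub_zero, map_mul]
      exact Ideal.mul_mem_left _ _ (Ideal.mem_map_of_mem _ (Ideal.subset_span ⟨i, rfl⟩))
  · rw [LinearIndependent, injective_iff_map_eq_zero]
    intro c hc
    have h2 : π (c.sum fun a r => MvPolynomial.monomial a.1 r) = 0 := by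
      rw [← hc, Finsupp.linearCombination_apply, Finsupp.sum, map_sum, Finsupp.sum]
      refine Finset.sum_congr rfl fun a _ => ?_
      rw [← mul_one (c a), ← smul_eq_mul, ← MvPolynomial.smul_monomial, map_smul, smul_eq_mul,
        mul_one, MvPolynomial.monomial_eq, map_one, one_mul]
      congr 1
      exact map_mon π.toRingHom _ _
    have h2' : (c.sum fun a r => MvPolynomial.monomial a.1 r) ∈ 𝔱 ^ (n + 1) :=
      Ideal.Quotient.eq_zero_iff_mem.mp h2
    rw [MvPolynomial.mem_pow_idealOfVars_iff'] at h2'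
    ext a
    have h3 := h2' a.1 (Nat.lt_succ_of_le a.2)
    rw [Finsupp.sum, MvPolynomial.coeff_sum] at h3
    simp only [MvPolynomial.coeff_monomial, Subtype.val_inj] at h3
    simpa using h3

/-! ### Generic rank of the modules of principal parts -/

/-- Over a domain, a linearly independent family has at most as many members as a system of
generators up to torsion. -/
theorem LinearIndependent.card_le_of_exists_smul_mem_span {R M ι : Type*} [CommRing R] [IsDomain R]
    [AddCommGroup M] [Module R M] [Fintype ι] {v : ι → M} (hv : LinearIndependent R v)
    {T : Set M} (hTfin : T.Finite)
    (hT : ∀ z : M, ∃ u ∈ nonZeroDivisors R, u • z ∈ Submodule.span R T) :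
    Fintype.card ι ≤ T.ncard := by
  classical
  choose u hu hmem using hT
  have hw : LinearIndependent R fun i => u (v i) • v i := by
    rw [Fintype.linearIndependent_iff] at hv ⊢
    intro g hg i
    have := hv (fun i => g i * u (v i)) (by simpa [mul_smul] using hg) i
    exact (mul_eq_zero.mp this).resolve_right (nonZeroDivisors.ne_zero (hu _))
  have hw' : LinearIndependent R
      (fun i => (⟨u (v i) • v i, hmem _⟩ : Submodule.span R T)) :=
    LinearIndependent.of_comp (Submodule.span R T).subtype hw
  have h1 := hw'.cardinal_lift_le_rank
  have h2 := rank_span_le (R := R) T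
  rw [← Set.cast_ncard hTfin] at h2
  simpa using h1.trans (Cardinal.lift_le.mpr h2)

/-- Among the differentials of elements of `R` there is a basis of the differentials of its fraction
field. -/
theorem exists_isBasis_D {K R F : Type*} [CommRing K] [CommRing R] [IsDomain R] [Field F]
    [Algebra K R] [Algebra K F] [Algebra R F] [IsScalarTower K R F] [IsFractionRing R F]
    [Module.Finite F Ω[F⁄K]] :
    ∃ (d : ℕ) (x : Fin d → R) (b : Module.Basis (Fin d) F Ω[F⁄K]),
      ∀ i, b i = KaehlerDifferential.D K F (algebraMap R F (x i)) := by
  classical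
  have hspan := KaehlerDifferential.span_range_map_derivation_of_isLocalization K R F
    (nonZeroDivisors R)
  obtain ⟨s, hs, hspan', hind⟩ := exists_linearIndependent F
    (Set.range (KaehlerDifferential.map K K R F ∘ KaehlerDifferential.D K R))
  let b₀ : Module.Basis s F Ω[F⁄K] := Module.Basis.mk hind (by
    rw [Subtype.range_coe, hspan', hspan])
  have : Finite s := Module.Finite.finite_basis b₀
  have := Fintype.ofFinite s
  let ε := Fintype.equivFin s
  have hx : ∀ t : s, ∃ r : R, KaehlerDifferential.map K K R F (KaehlerDifferential.D K R r) = t :=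
    fun t => hs t.2
  choose x hx using hx
  refine ⟨Fintype.card s, fun i => x (ε.symm i), b₀.reindex ε, fun i => ?_⟩
  rw [Module.Basis.reindex_apply, ← KaehlerDifferential.map_D K K R F, hx]
  simp [b₀]

section Generic

variable {K R F : Type*} [CommRing K] [CommRing R] [Algebra K R]

/-- Generators of `Ω[R⁄K]` up to multiplication by elements of `U` lift to generators of the
augmentation ideal of `R ⊗[K] R` modulo its square. -/
theorem exists_smul_mem_span_sup_sq {ι : Type*} (U : Submonoid R)
    (y : ι → KaehlerDifferential.ideal K R)
    (hy : ∀ ω : Ω[R⁄K], ∃ u ∈ U,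
      u • ω ∈ Submodule.span R (Set.range fun i => KaehlerDifferential.fromIdeal K R (y i)))
    {z : R ⊗[K] R} (hz : z ∈ KaehlerDifferential.ideal K R) :
    ∃ u ∈ U, u • z ∈ Submodule.span R (Set.range fun i => (y i : R ⊗[K] R)) ⊔
      (KaehlerDifferential.ideal K R ^ 2).restrictScalars R := by
  obtain ⟨u, hu, h⟩ := hy (KaehlerDifferential.fromIdeal K R ⟨z, hz⟩)
  refine ⟨u, hu, ?_⟩
  let f := (KaehlerDifferential.fromIdeal K R).restrictScalars R
  have h' : f (u • ⟨z, hz⟩) ∈ Submodule.map f (Submodule.span R (Set.range y)) := by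
    rw [Submodule.map_span, ← Set.range_comp, map_smul]
    exact h
  obtain ⟨t, ht, hft⟩ := h'
  have h0 : f (u • ⟨z, hz⟩ - t) = 0 := by rw [map_sub, hft, sub_self]
  have h2 : ((u • ⟨z, hz⟩ - t : KaehlerDifferential.ideal K R) : R ⊗[K] R) ∈
      KaehlerDifferential.ideal K R ^ 2 :=
    (Ideal.toCotangent_eq_zero _ _).mp h0
  have h3 : (t : R ⊗[K] R) ∈ Submodule.span R (Set.range fun i => (y i : R ⊗[K] R)) := by
    have h4 := Submodule.mem_map_of_mem
      (f := (KaehlerDifferential.ideal K R).subtype.restrictScalars R) ht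
    rw [Submodule.map_span, ← Set.range_comp] at h4
    exact h4
  have h5 : u • z = t + ((u • ⟨z, hz⟩ - t : KaehlerDifferential.ideal K R) : R ⊗[K] R) := by
    rw [Submodule.coe_sub, add_sub_cancel]
    rfl
  rw [h5]
  exact Submodule.add_mem_sup h3 h2

variable (K R) in
/-- The module of principal parts of order `n` as a quotient of `R`-modules, the scalars being
restricted to the left tensor factor before the quotient is taken. -/
abbrev PPart (n : ℕ) : Type _ :=
  (R ⊗[K] R) ⧸ (KaehlerDifferential.ideal K R ^ (n + 1)).restrictScalars R

/-- The class of the monomial with exponent `a` in the elements `y i` in the module of principal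
parts. -/
noncomputable def ppMon (n : ℕ) {d : ℕ} (y : Fin d → R ⊗[K] R) (a : Fin d →₀ ℕ) : PPart K R n :=
  Submodule.Quotient.mk (mon y a)

/-- Generators of `Ω[R⁄K]` up to multiplication by elements of `U` yield generators of the module
of principal parts up to multiplication by elements of `U`. -/
theorem exists_smul_mem_span_ppMon {d : ℕ} (U : Submonoid R)
    (y : Fin d → KaehlerDifferential.ideal K R)
    (hy : ∀ ω : Ω[R⁄K], ∃ u ∈ U,
      u • ω ∈ Submodule.span R (Set.range fun i => KaehlerDifferential.fromIdeal K R (y i)))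
    (n : ℕ) (z : PPart K R n) :
    ∃ u ∈ U, u • z ∈ Submodule.span R
      (ppMon n (fun i => (y i : R ⊗[K] R)) '' {a | a.degree ≤ n}) := by
  obtain ⟨z, rfl⟩ := Submodule.Quotient.mk_surjective _ z
  obtain ⟨u, hu, h⟩ := exists_smul_mem_span_mon (R := R) U
    (𝔫 := KaehlerDifferential.ideal K R) (fun i => (y i).2)
    (exists_sub_algebraMap_mem_ideal K)
    (fun z hz => exists_smul_mem_span_sup_sq U y hy hz) (j := 0) (n := n) (z := z) (by simp)
  refine ⟨u, hu, ?_⟩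
  obtain ⟨s, hs, t, ht, e⟩ := Submodule.mem_sup.mp h
  rw [← Submodule.Quotient.mk_smul, ← e, Submodule.Quotient.mk_add,
    (Submodule.Quotient.mk_eq_zero _).mpr ht, add_zero]
  have := Submodule.mem_map_of_mem
    (f := ((KaehlerDifferential.ideal K R ^ (n + 1)).restrictScalars R).mkQ) hs
  rw [Submodule.map_span, ← Set.image_comp] at this
  simp only [Nat.zero_le, true_and] at this
  exact this

instance PPart.finite [Module.Finite R Ω[R⁄K]] (n : ℕ) : Module.Finite R (PPart K R n) := by
  obtain ⟨d, w, hw⟩ := Module.Finite.exists_fin (R := R) (M := Ω[R⁄K])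
  choose y hy using fun i => KaehlerDifferential.fromIdeal_surjective K R (w i)
  have hy' : (fun i => KaehlerDifferential.fromIdeal K R (y i)) = w := funext hy
  refine ⟨⟨((Finsupp.finite_setOf_degree_le (Fin d) n).image
    (ppMon n (fun i => (y i : R ⊗[K] R)))).toFinset, ?_⟩⟩
  rw [Set.Finite.coe_toFinset, eq_top_iff]
  intro z _
  obtain ⟨u, hu, h⟩ := exists_smul_mem_span_ppMon (⊥ : Submonoid R) y
    (fun ω => ⟨1, rfl, by rw [hy', hw]; trivial⟩) n z
  rwa [Submonoid.mem_bot.mp hu, one_smul] at h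

variable [Field F] [Algebra K F] [Algebra R F] [IsScalarTower K R F]
  [IsFractionRing R F]

/-- The `D (x i)` generate `Ω[R⁄K]` up to torsion if they form a basis over the fraction field. -/
theorem exists_smul_mem_span_D {d : ℕ} {x : Fin d → R} (b : Module.Basis (Fin d) F Ω[F⁄K])
    (hb : ∀ i, b i = KaehlerDifferential.D K F (algebraMap R F (x i))) (ω : Ω[R⁄K]) :
    ∃ u ∈ nonZeroDivisors R,
      u • ω ∈ Submodule.span R (Set.range fun i => KaehlerDifferential.D K R (x i)) := by
  classical
  obtain ⟨⟨u, hu⟩, h⟩ := IsLocalization.exist_integer_multiples (nonZeroDivisors R) Finset.univ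
    fun i => b.repr (KaehlerDifferential.map K K R F ω) i
  choose r hr using fun i => h i (Finset.mem_univ i)
  have h1 : KaehlerDifferential.map K K R F (u • ω - ∑ i, r i • KaehlerDifferential.D K R (x i))
      = 0 := by
    rw [map_sub, map_smul, map_sum, sub_eq_zero]
    conv_lhs => rw [← b.sum_repr (KaehlerDifferential.map K K R F ω), Finset.smul_sum]
    refine Finset.sum_congr rfl fun i _ => ?_
    rw [map_smul, KaehlerDifferential.map_D, hb, ← smul_assoc, ← algebraMap_smul F (r i), hr]
  rw [IsLocalizedModule.eq_zero_iff (nonZeroDivisors R)] at h1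
  obtain ⟨⟨v, hv⟩, h2⟩ := h1
  refine ⟨v * u, mul_mem hv hu, ?_⟩
  replace h2 : v • (u • ω - ∑ i, r i • KaehlerDifferential.D K R (x i)) = 0 := h2
  rw [smul_sub, sub_eq_zero] at h2
  rw [mul_smul, h2]
  exact Submodule.smul_mem _ _ (Submodule.sum_mem _ fun i _ =>
    Submodule.smul_mem _ _ (Submodule.subset_span ⟨i, rfl⟩))

/-- The monomials in the `1 ⊗ x i - x i ⊗ 1` are independent over `R` because they are so over the
fraction field. -/
theorem linearIndependent_ppMon [Algebra.FormallySmooth K F] {d : ℕ} {x : Fin d → R}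
    (b : Module.Basis (Fin d) F Ω[F⁄K])
    (hb : ∀ i, b i = KaehlerDifferential.D K F (algebraMap R F (x i))) (n : ℕ) :
    LinearIndependent R fun a : {a : Fin d →₀ ℕ // a.degree ≤ n} =>
      ppMon n (fun i => diffTensor K (x i)) a.1 := by
  classical
  rw [LinearIndependent, injective_iff_map_eq_zero]
  intro c hc
  have h1 : c.sum (fun a r => r • mon (fun i => diffTensor K (x i)) a.1) ∈
      KaehlerDifferential.ideal K R ^ (n + 1) := by
    rw [← Submodule.restrictScalars_mem R, ← Submodule.Quotient.mk_eq_zero, ← hc,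
      Finsupp.linearCombination_apply, ← Submodule.mkQ_apply, map_finsuppSum]
    rfl
  let θ : R ⊗[K] R →ₐ[K] F ⊗[K] F :=
    Algebra.TensorProduct.map (IsScalarTower.toAlgHom K R F) (IsScalarTower.toAlgHom K R F)
  have hθ : ∀ r, θ (diffTensor K r) = diffTensor K (algebraMap R F r) := fun r => by
    simp [θ, diffTensor]
  have hθΔ : KaehlerDifferential.ideal K R ≤
      (KaehlerDifferential.ideal K F).comap (θ : R ⊗[K] R →+* F ⊗[K] F) := by
    rw [← KaehlerDifferential.span_range_eq_ideal, Ideal.span_le]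
    rintro _ ⟨r, rfl⟩
    have := diffTensor_mem K (algebraMap R F r)
    rw [← hθ] at this
    exact this
  have h2 : θ (c.sum fun a r => r • mon (fun i => diffTensor K (x i)) a.1) ∈
      KaehlerDifferential.ideal K F ^ (n + 1) :=
    Ideal.le_comap_pow _ _ (Ideal.pow_right_mono hθΔ (n + 1) h1)
  have h3 := eq_zero_of_sum_smul_mon_diffTensor_mem b _ hb n
    (c.mapRange (algebraMap R F) (map_zero _)) (by
      convert h2 using 1
      rw [Finsupp.sum_mapRange_index (by simp), map_finsuppSum]
      refine Finsupp.sum_congr fun a _ => ?_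
      rw [Algebra.smul_def, Algebra.smul_def, map_mul]
      congr 1
      · simp [θ, Algebra.TensorProduct.algebraMap_apply]
      · rw [show θ (mon (fun i => diffTensor K (x i)) a.1) = _ from
          map_mon (θ : R ⊗[K] R →+* F ⊗[K] F) _ _]
        congr 1
        funext i
        exact (hθ _).symm)
  ext a
  have h4 := DFunLike.congr_fun h3 a
  simpa using h4

/-- The generic rank of `Ω[R⁄K]` bounds the size of independent families. -/
theorem LinearIndependent.card_le_of_isBasis_D [IsDomain R] {d : ℕ} {x : Fin d → R}
    (b : Module.Basis (Fin d) F Ω[F⁄K])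
    (hb : ∀ i, b i = KaehlerDifferential.D K F (algebraMap R F (x i)))
    {ι : Type*} [Fintype ι] {v : ι → Ω[R⁄K]} (hv : LinearIndependent R v) :
    Fintype.card ι ≤ d := by
  have h1 := hv.card_le_of_exists_smul_mem_span (Set.finite_range _) (exists_smul_mem_span_D b hb)
  refine h1.trans ?_
  rw [← Set.image_univ]
  exact (Set.ncard_image_le Set.finite_univ).trans (by simp [Set.ncard_univ])

/-- The generic rank of the module of principal parts bounds the size of independent families. -/
theorem LinearIndependent.card_le_numMonomials [IsDomain R] {d : ℕ} {x : Fin d → R}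
    (b : Module.Basis (Fin d) F Ω[F⁄K])
    (hb : ∀ i, b i = KaehlerDifferential.D K F (algebraMap R F (x i))) {n : ℕ}
    {ι : Type*} [Fintype ι] {v : ι → PPart K R n} (hv : LinearIndependent R v) :
    Fintype.card ι ≤ numMonomials d n :=
  (hv.card_le_of_exists_smul_mem_span ((Finsupp.finite_setOf_degree_le _ n).image _)
    (exists_smul_mem_span_ppMon _ (fun i => ⟨diffTensor K (x i), diffTensor_mem K _⟩)
      (exists_smul_mem_span_D b hb) n)).trans
    (Set.ncard_image_le (Finsupp.finite_setOf_degree_le _ n))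

/-- The fibre of the module of principal parts at a proper ideal needs at least as many generators
as the generic rank. -/
theorem numMonomials_le_card [IsDomain R] [Algebra.FormallySmooth K F] [Module.Finite R Ω[R⁄K]]
    {d : ℕ} {x : Fin d → R} (b : Module.Basis (Fin d) F Ω[F⁄K])
    (hb : ∀ i, b i = KaehlerDifferential.D K F (algebraMap R F (x i))) {m : Ideal R} (hm : m ≠ ⊤)
    {n : ℕ} {T : Finset (PPart K R n)} (hT : Submodule.span R (T : Set (PPart K R n)) ⊔ m • ⊤ = ⊤) :
    numMonomials d n ≤ T.card := by
  classical
  obtain ⟨u, hum, hu⟩ := Submodule.exists_sub_one_mem_and_smul_le_of_fg_of_le_sup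
    (I := m) (N := Submodule.span R (T : Set (PPart K R n))) (N' := ⊤) (P := ⊤)
    Module.Finite.fg_top le_rfl hT.ge
  have hu0 : u ≠ 0 := by
    rintro rfl
    rw [zero_sub, neg_mem_iff] at hum
    exact hm ((Ideal.eq_top_iff_one m).mpr hum)
  have : Fintype {a : Fin d →₀ ℕ // a.degree ≤ n} :=
    (Finsupp.finite_setOf_degree_le (Fin d) n).fintype
  have h1 := (linearIndependent_ppMon b hb n).card_le_of_exists_smul_mem_span T.finite_toSet
    fun z => ⟨u, mem_nonZeroDivisors_of_ne_zero hu0,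
      hu (Submodule.smul_mem_pointwise_smul z u ⊤ trivial)⟩
  rw [Set.ncard_coe_finset] at h1
  refine le_trans (le_of_eq ?_) h1
  rw [← Nat.card_eq_fintype_card]
  rfl

end Generic

/-! ### Detecting elements by functionals -/

section Functionals

variable {R M : Type*} [CommRing R] [AddCommGroup M] [Module R M]

/-- If linear functionals detect the elements outside `m • ⊤`, then a family that is independent
modulo a maximal ideal `m` has functionals dual to it modulo `m`, and so is linearly
independent. -/
theorem linearIndependent_of_detects [IsDomain R] {m : Ideal R} (hm : m.IsMaximal)
    (hM : ∀ w : M, w ∉ m • (⊤ : Submodule R M) → ∃ φ : M →ₗ[R] R, φ w ∉ m)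
    {k : ℕ} {v : Fin k → M}
    (hv : ∀ c : Fin k → R, ∑ i, c i • v i ∈ m • (⊤ : Submodule R M) → ∀ i, c i ∈ m) :
    LinearIndependent R v := by
  classical
  let _ := Ideal.Quotient.field m
  let Ψ : (M →ₗ[R] R) →ₗ[R] (Fin k → R ⧸ m) :=
    LinearMap.pi fun i => (Algebra.linearMap R (R ⧸ m)) ∘ₗ LinearMap.applyₗ (v i)
  have hΨ : ∀ φ i, Ψ φ i = Ideal.Quotient.mk m (φ (v i)) := fun φ i => rfl
  have htop : Submodule.span (R ⧸ m) (Set.range Ψ) = ⊤ := by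
    by_contra hne
    obtain ⟨f, hf0, hf⟩ := Submodule.exists_le_ker_of_lt_top _ (lt_top_iff_ne_top.mpr hne)
    choose c hc using fun i => Ideal.Quotient.mk_surjective (f (Pi.single i 1))
    have hfsum : ∀ w, f w = ∑ i, w i * Ideal.Quotient.mk m (c i) := by
      intro w
      conv_lhs => rw [← Finset.univ_sum_single w, map_sum]
      refine Finset.sum_congr rfl fun i _ => ?_
      rw [hc, ← smul_eq_mul, ← map_smul, ← Pi.single_smul, smul_eq_mul, mul_one]
    have hcm : ∀ i, c i ∈ m := by
      refine hv c ?_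
      by_contra hw
      obtain ⟨φ, hφ⟩ := hM _ hw
      refine hφ ?_
      have h1 : f (Ψ φ) = 0 := hf (Submodule.subset_span ⟨φ, rfl⟩)
      rw [← Ideal.Quotient.eq_zero_iff_mem, ← h1, hfsum, map_sum, map_sum]
      refine Finset.sum_congr rfl fun i _ => ?_
      rw [hΨ, map_smul, smul_eq_mul, map_mul, mul_comm]
    refine hf0 (LinearMap.ext fun w => ?_)
    rw [hfsum]
    simp [Ideal.Quotient.eq_zero_iff_mem.mpr (hcm _)]
  have hsurj : Function.Surjective Ψ := by
    rw [← LinearMap.range_eq_top, eq_top_iff]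
    intro w _
    have h1 : w ∈ (Submodule.span (R ⧸ m) (Set.range Ψ)).restrictScalars R := by
      rw [htop]; trivial
    rw [Submodule.restrictScalars_span R (R ⧸ m) Ideal.Quotient.mk_surjective,
      ← LinearMap.coe_range, Submodule.span_eq] at h1
    exact h1
  choose φ hφ using fun j => hsurj (Pi.single j 1)
  let N : Matrix (Fin k) (Fin k) R := Matrix.of fun j i => φ j (v i)
  have hN : N.det ≠ 0 := by
    intro h0
    have h1 : (Ideal.Quotient.mk m).mapMatrix N = 1 := by
      ext j i
      change Ideal.Quotient.mk m (φ j (v i)) = _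
      rw [← hΨ, hφ, Matrix.one_apply, Pi.single_apply]
      exact if_congr eq_comm rfl rfl
    have h2 := RingHom.map_det (Ideal.Quotient.mk m) N
    rw [h1, h0, map_zero, Matrix.det_one] at h2
    exact zero_ne_one h2
  rw [Fintype.linearIndependent_iff]
  intro g hg
  have h1 : N.mulVec g = 0 := by
    ext j
    have : φ j (∑ i, g i • v i) = 0 := by rw [hg, map_zero]
    rw [map_sum] at this
    simp only [Matrix.mulVec, dotProduct, Pi.zero_apply, ← this, N, Matrix.of_apply]
    refine Finset.sum_congr rfl fun i _ => ?_
    rw [map_smul, smul_eq_mul, mul_comm]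
  exact fun i => congrFun (Matrix.eq_zero_of_mulVec_eq_zero hN h1) i

/-- Functionals on a projective module detect the elements outside `m • ⊤`, since every element is a
combination with coefficients given by functionals. -/
theorem Module.Projective.exists_notMem [Module.Projective R M] {m : Ideal R} {w : M}
    (hw : w ∉ m • (⊤ : Submodule R M)) : ∃ φ : M →ₗ[R] R, φ w ∉ m := by
  by_contra! h
  obtain ⟨s, hs⟩ := Module.projective_def.mp ‹Module.Projective R M›
  refine hw ?_
  rw [← hs w, Finsupp.linearCombination_apply, Finsupp.sum]
  exact Submodule.sum_mem _ fun x _ =>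
    Submodule.smul_mem_smul (h (Finsupp.lapply x ∘ₗ s)) trivial

/-- A system of generators of a finite module contains a minimal one modulo a maximal ideal. -/
theorem exists_minimal_generators_mod [Module.Finite R M] {m : Ideal R} (hm : m.IsMaximal)
    {S : Set M} (hS : Submodule.span R S = ⊤) :
    ∃ (e : ℕ) (w : Fin e → M), (∀ i, w i ∈ S) ∧ Submodule.span R (Set.range w) ⊔ m • ⊤ = ⊤ ∧
      ∀ c : Fin e → R, ∑ i, c i • w i ∈ m • (⊤ : Submodule R M) → ∀ i, c i ∈ m := by
  classical
  let _ := Ideal.Quotient.field m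
  have : Module.Finite (R ⧸ m) (M ⧸ m • (⊤ : Submodule R M)) :=
    Module.Finite.of_restrictScalars_finite R _ _
  let π := (m • (⊤ : Submodule R M)).mkQ
  have hspan : Submodule.span (R ⧸ m) (π '' S) = ⊤ := by
    rw [← Submodule.restrictScalars_eq_top_iff R,
      Submodule.restrictScalars_span R (R ⧸ m) Ideal.Quotient.mk_surjective, ← Submodule.map_span,
      hS, Submodule.map_top, Submodule.range_mkQ]
  obtain ⟨s, hs, hspan', hind⟩ := exists_linearIndependent (R ⧸ m) (π '' S)
  let b₀ : Module.Basis s (R ⧸ m) (M ⧸ m • (⊤ : Submodule R M)) := Module.Basis.mk hind (by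
    rw [Subtype.range_coe, hspan', hspan])
  have : Finite s := Module.Finite.finite_basis b₀
  have := Fintype.ofFinite s
  let b := b₀.reindex (Fintype.equivFin s)
  have hb : ∀ i, b i ∈ π '' S := fun i => by
    rw [Module.Basis.reindex_apply, Module.Basis.mk_apply]
    exact hs (Subtype.coe_prop _)
  choose w hwS hw using hb
  refine ⟨_, w, hwS, ?_, ?_⟩
  · have h1 : Submodule.span R (Set.range b) = ⊤ := by
      rw [← Submodule.restrictScalars_span R (R ⧸ m) Ideal.Quotient.mk_surjective, b.span_eq]
      rfl
    have h2 : Submodule.map (m • (⊤ : Submodule R M)).mkQ (Submodule.span R (Set.range w)) = ⊤ := by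
      rw [Submodule.map_span, ← Set.range_comp, ← h1]
      congr 2
      funext i
      exact hw i
    rw [sup_comm, ← Submodule.comap_map_mkQ, h2, Submodule.comap_top]
  · intro c hc i
    rw [← Submodule.Quotient.mk_eq_zero, ← Submodule.mkQ_apply, map_sum] at hc
    have h1 : ∑ i, Ideal.Quotient.mk m (c i) • b i = 0 := by
      rw [← hc]
      refine Finset.sum_congr rfl fun i _ => ?_
      rw [map_smul, show (m • (⊤ : Submodule R M)).mkQ (w i) = b i from hw i]
      rfl
    exact Ideal.Quotient.eq_zero_iff_mem.mp
      (Fintype.linearIndependent_iff.mp b.linearIndependent _ h1 i)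

end Functionals

/-! ### Differential operators as functionals on principal parts -/

section DiffOp

variable {K R : Type*} [CommRing K] [CommRing R] [Algebra K R]

/-- The `R`-linear extension `r ⊗ f ↦ r * δ f` of a `K`-linear map `δ`. -/
noncomputable def tensorExtend (δ : R →ₗ[K] R) : R ⊗[K] R →ₗ[R] R :=
  TensorProduct.AlgebraTensorModule.lift ((LinearMap.lsmul R (R →ₗ[K] R)).flip δ)

@[simp]
theorem tensorExtend_tmul (δ : R →ₗ[K] R) (r f : R) : tensorExtend δ (r ⊗ₜ f) = r * δ f := rfl

/-- Multiplication by `1 ⊗ r - r ⊗ 1` corresponds to the commutator with `r`. -/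
theorem tensorExtend_diffTensor_mul (δ : R →ₗ[K] R) (r : R) (z : R ⊗[K] R) :
    tensorExtend δ (diffTensor K r * z) =
      tensorExtend (δ ∘ₗ LinearMap.mulLeft K r - LinearMap.mulLeft K r ∘ₗ δ) z := by
  induction z with
  | zero => simp
  | add a b ha hb => rw [mul_add, map_add, map_add, ha, hb]
  | tmul s f =>
    simp only [diffTensor, sub_mul, Algebra.TensorProduct.tmul_mul_tmul, one_mul, map_sub,
      tensorExtend_tmul, LinearMap.sub_apply, LinearMap.comp_apply, LinearMap.mulLeft_apply]
    ring

theorem tensorExtend_eq_zero_of_mem_mul {δ : R →ₗ[K] R} {J : Ideal (R ⊗[K] R)}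
    (h : ∀ r, ∀ z ∈ J,
      tensorExtend (δ ∘ₗ LinearMap.mulLeft K r - LinearMap.mulLeft K r ∘ₗ δ) z = 0)
    {z : R ⊗[K] R} (hz : z ∈ KaehlerDifferential.ideal K R * J) : tensorExtend δ z = 0 := by
  induction hz using Submodule.mul_induction_on' with
  | add x hx y hy ihx ihy => rw [map_add, ihx, ihy, add_zero]
  | mem_mul_mem a ha b hb =>
    rw [← KaehlerDifferential.span_range_eq_ideal] at ha
    induction ha using Submodule.span_induction generalizing b with
    | zero => simp
    | add x y _ _ ihx ihy => rw [add_mul, map_add, ihx b hb, ihy b hb, add_zero]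
    | smul c x _ ih =>
      rw [smul_eq_mul, mul_comm c x, mul_assoc]
      exact ih _ (J.mul_mem_left c hb)
    | mem x hx =>
      obtain ⟨r, rfl⟩ := hx
      exact (tensorExtend_diffTensor_mul δ r b).trans (h r b hb)

theorem IsDiffOp.tensorExtend_eq_zero {n : ℕ} {δ : R →ₗ[K] R} (h : IsDiffOp K n δ)
    {z : R ⊗[K] R} (hz : z ∈ KaehlerDifferential.ideal K R ^ (n + 1)) : tensorExtend δ z = 0 := by
  induction n generalizing δ z with
  | zero =>
    rw [zero_add, pow_one, ← Ideal.mul_top (KaehlerDifferential.ideal K R)] at hz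
    refine tensorExtend_eq_zero_of_mem_mul (fun r z _ => ?_) hz
    have h' : ∀ r x : R, δ (r * x) = r * δ x := h
    have : δ ∘ₗ LinearMap.mulLeft K r - LinearMap.mulLeft K r ∘ₗ δ = 0 := by
      ext x
      simp [h']
    rw [this]
    induction z with
    | zero => simp
    | add a b ha hb => rw [map_add, ha trivial, hb trivial, add_zero]
    | tmul s f => simp
  | succ n ih =>
    rw [pow_succ'] at hz
    exact tensorExtend_eq_zero_of_mem_mul (fun r z hz => ih (h r) hz) hz

theorem IsDiffOp.exists_linearMap {n : ℕ} {δ : R →ₗ[K] R} (h : IsDiffOp K n δ) :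
    ∃ φ : PPart K R n →ₗ[R] R, ∀ f : R, φ (Submodule.Quotient.mk (1 ⊗ₜ f)) = δ f :=
  ⟨Submodule.liftQ _ (tensorExtend δ) fun _ hz => h.tensorExtend_eq_zero hz, fun f => by
    change tensorExtend δ (1 ⊗ₜ f) = δ f
    rw [tensorExtend_tmul, one_mul]⟩

end DiffOp

/-! ### Fibres of principal parts -/

/-- If `C = G(R) + 𝔫` and `𝔫 = G(m) + 𝔫 ^ 2`, then `C = G(R) + 𝔫 ^ n`. -/
theorem RingHom.exists_sub_mem_pow {R C : Type*} [CommRing R] [CommRing C] (G : R →+* C)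
    {m : Ideal R} {𝔫 : Ideal C} (hG : ∀ f ∈ m, G f ∈ 𝔫) (h0 : ∀ c, ∃ f, c - G f ∈ 𝔫)
    (h1 : ∀ z ∈ 𝔫, ∃ f ∈ m, z - G f ∈ 𝔫 ^ 2) (n : ℕ) (c : C) : ∃ f, c - G f ∈ 𝔫 ^ n := by
  algebraize [G]
  have hV : ∀ j, Submodule.map (Algebra.linearMap R C) (m ^ j) ≤
      (𝔫 ^ j).restrictScalars R := by
    rintro j _ ⟨f, hf, rfl⟩
    exact Ideal.le_comap_pow (f := G) (K := 𝔫) j (Ideal.pow_right_mono hG j hf)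
  have hmul : ∀ j, Submodule.map (Algebra.linearMap R C) (m ^ j) *
      Submodule.map (Algebra.linearMap R C) (m ^ 1) ≤
      Submodule.map (Algebra.linearMap R C) (m ^ (j + 1)) := by
    intro j
    rw [Submodule.mul_le]
    rintro _ ⟨f, hf, rfl⟩ _ ⟨g, hg, rfl⟩
    rw [pow_one] at hg
    exact ⟨f * g, Ideal.mul_mem_mul hf hg, map_mul G f g⟩
  have h0' : ∀ c, ∃ u ∈ (⊥ : Submonoid R),
      u • c ∈ Submodule.map (Algebra.linearMap R C) (m ^ 0) ⊔ 𝔫.restrictScalars R := by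
    intro c
    obtain ⟨f, hf⟩ := h0 c
    refine ⟨1, rfl, ?_⟩
    rw [one_smul, ← add_sub_cancel (G f) c]
    exact Submodule.add_mem_sup ⟨f, by simp, rfl⟩ hf
  have h1' : ∀ z ∈ 𝔫, ∃ u ∈ (⊥ : Submonoid R),
      u • z ∈ Submodule.map (Algebra.linearMap R C) (m ^ 1) ⊔ (𝔫 ^ 2).restrictScalars R := by
    intro z hz
    obtain ⟨f, hfm, hf⟩ := h1 z hz
    refine ⟨1, rfl, ?_⟩
    rw [one_smul, ← add_sub_cancel (G f) z]
    exact Submodule.add_mem_sup ⟨f, by simpa using hfm, rfl⟩ hf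
  obtain ⟨u, hu, h⟩ := exists_smul_mem_sup_pow ⊥ 𝔫
    (fun j => Submodule.map (Algebra.linearMap R C) (m ^ j)) hV hmul h0' h1'
    (W := LinearMap.range (Algebra.linearMap R C)) (j := 0) (n := n)
    (fun i _ _ => LinearMap.map_le_range) (z := c) (by rw [pow_zero, Ideal.one_eq_top]; trivial)
  rw [Submonoid.mem_bot.mp hu, one_smul] at h
  obtain ⟨_, ⟨f, rfl⟩, t, ht, rfl⟩ := Submodule.mem_sup.mp h
  refine ⟨f, ?_⟩
  rwa [show G f = Algebra.linearMap R C f from rfl, add_sub_cancel_left]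

section Fibre

variable {K R : Type*} [CommRing R]

section

variable [CommRing K] [Algebra K R]

variable (K) in
/-- The fibre `(R ⧸ m) ⊗[K] R` of `R ⊗[K] R` over the ideal `m`, as a quotient of `R ⊗[K] R`. -/
abbrev TensorFibre (m : Ideal R) : Type _ := (R ⊗[K] R) ⧸ m.map (algebraMap R (R ⊗[K] R))

variable (K) in
/-- The kernel of the multiplication map `(R ⧸ m) ⊗[K] R → R ⧸ m`. -/
noncomputable abbrev fibreIdeal (m : Ideal R) : Ideal (TensorFibre K m) :=
  (KaehlerDifferential.ideal K R).map (Ideal.Quotient.mk _)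

theorem TensorFibre.algebraMap_eq_zero {m : Ideal R} {r : R} (hr : r ∈ m) :
    algebraMap R (TensorFibre K m) r = 0 :=
  Ideal.Quotient.eq_zero_iff_mem.mpr (Ideal.mem_map_of_mem _ hr)

theorem mk_mem_fibreIdeal_pow_iff {m : Ideal R} {n : ℕ} {p : R ⊗[K] R} :
    Ideal.Quotient.mk (m.map (algebraMap R (R ⊗[K] R))) p ∈ fibreIdeal K m ^ n ↔
      p ∈ KaehlerDifferential.ideal K R ^ n ⊔ m.map (algebraMap R (R ⊗[K] R)) := by
  rw [← Ideal.map_pow, Ideal.mem_quotient_iff_mem_sup]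

theorem PPart.mk_mem_smul_top_iff {m : Ideal R} {n : ℕ} {p : R ⊗[K] R} :
    (Submodule.Quotient.mk p : PPart K R n) ∈ m • (⊤ : Submodule R (PPart K R n)) ↔
      Ideal.Quotient.mk (m.map (algebraMap R (R ⊗[K] R))) p ∈ fibreIdeal K m ^ (n + 1) := by
  rw [mk_mem_fibreIdeal_pow_iff]
  have h1 : m • (⊤ : Submodule R (PPart K R n)) = Submodule.map
      ((KaehlerDifferential.ideal K R ^ (n + 1)).restrictScalars R).mkQ
      ((m.map (algebraMap R (R ⊗[K] R))).restrictScalars R) := by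
    rw [← Ideal.smul_top_eq_map, Submodule.map_smul'', Submodule.map_top, Submodule.range_mkQ]
  rw [h1, ← Submodule.mkQ_apply, ← Submodule.mem_comap, Submodule.comap_map_mkQ,
    ← Submodule.restrictScalars_mem R (_ ⊔ _)]
  rw [Submodule.mem_sup, Submodule.restrictScalars_mem, Submodule.mem_sup]
  rfl

theorem exists_sub_algebraMap_mem_fibreIdeal (m : Ideal R) (c : TensorFibre K m) :
    ∃ r : R, c - algebraMap R (TensorFibre K m) r ∈ fibreIdeal K m := by
  obtain ⟨p, rfl⟩ := Ideal.Quotient.mk_surjective c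
  obtain ⟨r, hr⟩ := exists_sub_algebraMap_mem_ideal K p
  exact ⟨r, Ideal.mem_map_of_mem (Ideal.Quotient.mk _) hr⟩

/-- The map `R → (R ⧸ m) ⊗[K] R` into the right factor. -/
noncomputable def fibreRight (K : Type*) [CommRing K] [Algebra K R] (m : Ideal R) :
    R →+* TensorFibre K m :=
  (Ideal.Quotient.mk _).comp
    (Algebra.TensorProduct.includeRight : R →ₐ[K] R ⊗[K] R).toRingHom

theorem fibreRight_sub_algebraMap (m : Ideal R) (r : R) :
    fibreRight K m r - algebraMap R (TensorFibre K m) r =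
      Ideal.Quotient.mk _ (diffTensor K r) :=
  (map_sub (Ideal.Quotient.mk (m.map (algebraMap R (R ⊗[K] R))))
    ((1 : R) ⊗ₜ[K] r) (r ⊗ₜ[K] (1 : R))).symm

theorem fibreRight_sub_algebraMap_mem (m : Ideal R) (r : R) :
    fibreRight K m r - algebraMap R (TensorFibre K m) r ∈ fibreIdeal K m := by
  rw [fibreRight_sub_algebraMap]
  exact Ideal.mem_map_of_mem _ (diffTensor_mem K r)

theorem fibreRight_mem {m : Ideal R} {r : R} (hr : r ∈ m) : fibreRight K m r ∈ fibreIdeal K m := by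
  have := fibreRight_sub_algebraMap_mem (K := K) m r
  rwa [TensorFibre.algebraMap_eq_zero hr, sub_zero] at this

/-- The chain rule `d (g r) = g' r • d r` in `R ⊗[K] R`, modulo the square of the augmentation
ideal. -/
theorem diffTensor_aeval_sub_mem (g : Polynomial K) (r : R) :
    diffTensor K (Polynomial.aeval r g) -
      Polynomial.aeval r (Polynomial.derivative g) • diffTensor K r ∈
        KaehlerDifferential.ideal K R ^ 2 := by
  have h1 : ∀ r, KaehlerDifferential.D K R r =
      (KaehlerDifferential.fromIdeal K R).restrictScalars R ⟨diffTensor K r, diffTensor_mem K r⟩ :=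
    fun r => KaehlerDifferential.D_apply K R r
  have h2 := Derivation.map_aeval (KaehlerDifferential.D K R) g r
  rw [h1, h1, ← map_smul, ← sub_eq_zero, ← map_sub] at h2
  exact (Ideal.toCotangent_eq_zero _ _).mp h2

end

variable [Field K] [Algebra K R]

/-- If `R ⧸ m` is a separable algebraic extension of `K`, then the right factor surjects onto the
infinitesimal neighbourhoods of the point `m` in the fibre: if `g` is the minimal polynomial of
`r` modulo `m`, then `g r ∈ m` has differential `g' r • d r` with `g' r ∉ m`. -/
theorem exists_sub_fibreRight_mem_pow {m : Ideal R} (hm : m.IsMaximal)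
    [Algebra.IsSeparable K (R ⧸ m)] (n : ℕ) (c : TensorFibre K m) :
    ∃ f, c - fibreRight K m f ∈ fibreIdeal K m ^ n := by
  have : Nontrivial (R ⧸ m) := Ideal.Quotient.nontrivial_iff.mpr hm.ne_top
  -- replacing left scalars by right scalars
  have hscal : ∀ (r : R), ∀ z ∈ fibreIdeal K m,
      algebraMap R (TensorFibre K m) r * z - fibreRight K m r * z ∈ fibreIdeal K m ^ 2 := by
    intro r z hz
    have h : algebraMap R (TensorFibre K m) r * z - fibreRight K m r * z =
        -((fibreRight K m r - algebraMap R (TensorFibre K m) r) * z) := by ring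
    rw [h, neg_mem_iff, pow_two]
    exact Ideal.mul_mem_mul (fibreRight_sub_algebraMap_mem m r) hz
  have hd : ∀ r, ∃ f ∈ m, Ideal.Quotient.mk _ (diffTensor K r) - fibreRight K m f ∈
      fibreIdeal K m ^ 2 := by
    intro r
    let g := minpoly K (Ideal.Quotient.mk m r)
    have hgr : Polynomial.aeval r g ∈ m := by
      rw [← Ideal.Quotient.eq_zero_iff_mem]
      have := Polynomial.aeval_algHom_apply (Ideal.Quotient.mkₐ K m) r g
      exact this.symm.trans (minpoly.aeval K _)
    have hg'r : Polynomial.aeval r (Polynomial.derivative g) ∉ m := by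
      rw [← Ideal.Quotient.eq_zero_iff_mem]
      have := Polynomial.aeval_algHom_apply (Ideal.Quotient.mkₐ K m) r (Polynomial.derivative g)
      intro h0
      exact (Algebra.IsSeparable.isSeparable K (Ideal.Quotient.mk m r)).aeval_derivative_ne_zero
        (minpoly.aeval K _) (this.trans h0)
    obtain ⟨s, k, hk, hs⟩ := hm.exists_inv hg'r
    refine ⟨s * Polynomial.aeval r g, m.mul_mem_left _ hgr, ?_⟩
    have h1 := Ideal.mem_map_of_mem (Ideal.Quotient.mk (m.map (algebraMap R (R ⊗[K] R))))
      (diffTensor_aeval_sub_mem g r)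
    rw [Ideal.map_pow, map_sub, ← fibreRight_sub_algebraMap, TensorFibre.algebraMap_eq_zero hgr,
      sub_zero, Algebra.smul_def, map_mul] at h1
    have h2 := hscal s _ (fibreRight_mem (K := K) hgr)
    have h3 := Ideal.mul_mem_left _ (algebraMap R (TensorFibre K m) s) h1
    have h4 : algebraMap R (TensorFibre K m) (s * Polynomial.aeval r (Polynomial.derivative g))
        = 1 := by
      have := congrArg (algebraMap R (TensorFibre K m)) hs
      rwa [map_add, TensorFibre.algebraMap_eq_zero hk, add_zero, map_one] at this
    rw [map_mul] at h4 ⊢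
    have h5 := sub_mem h2 h3
    convert h5 using 1
    rw [mul_sub, ← mul_assoc]
    change _ = _ - (_ - algebraMap R (TensorFibre K m) s * algebraMap R (TensorFibre K m) _ * _)
    rw [h4]
    ring
  have hsurj : ∀ c, ∃ f, c - fibreRight K m f ∈ fibreIdeal K m := by
    intro c
    obtain ⟨r, hr⟩ := exists_sub_algebraMap_mem_fibreIdeal m c
    refine ⟨r, ?_⟩
    have := sub_mem hr (fibreRight_sub_algebraMap_mem (K := K) m r)
    rwa [sub_sub_sub_cancel_right] at this
  refine RingHom.exists_sub_mem_pow (fibreRight K m) (m := m) (𝔫 := fibreIdeal K m)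
    (fun f hf => fibreRight_mem hf) hsurj (fun z hz => ?_) n c
  · have hz' : z ∈ Ideal.span (Set.range fun r =>
        Ideal.Quotient.mk (m.map (algebraMap R (R ⊗[K] R))) (diffTensor K r)) := by
      rw [fibreIdeal, ← KaehlerDifferential.span_range_eq_ideal, Ideal.map_span,
        ← Set.range_comp] at hz
      exact hz
    clear hz
    induction hz' using Submodule.span_induction with
    | zero => exact ⟨0, zero_mem _, by simp⟩
    | mem x hx =>
      obtain ⟨r, rfl⟩ := hx
      exact hd r
    | add x y hx hy ihx ihy =>
      obtain ⟨f, hf, h⟩ := ihx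
      obtain ⟨f', hf', h'⟩ := ihy
      refine ⟨f + f', add_mem hf hf', ?_⟩
      rw [map_add, add_sub_add_comm]
      exact add_mem h h'
    | smul c x hx ih =>
      have hx' : x ∈ fibreIdeal K m := by
        refine (Ideal.span_le.mpr ?_ : _ ≤ fibreIdeal K m) hx
        rintro _ ⟨r, rfl⟩
        exact Ideal.mem_map_of_mem _ (diffTensor_mem K r)
      obtain ⟨f, hf, h⟩ := ih
      obtain ⟨a, ha⟩ := hsurj c
      refine ⟨a * f, m.mul_mem_left _ hf, ?_⟩
      have h1 : (c - fibreRight K m a) * x ∈ fibreIdeal K m ^ 2 := by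
        rw [pow_two]
        exact Ideal.mul_mem_mul ha hx'
      have h2 : c • x - fibreRight K m (a * f) =
          (c - fibreRight K m a) * x + fibreRight K m a * (x - fibreRight K m f) := by
        rw [map_mul, smul_eq_mul]; ring
      rw [h2]
      exact add_mem h1 (Ideal.mul_mem_left _ _ h)

end Fibre

/-! ### Comparison of the fibres with the generic rank -/

section Comparison

variable {K R F : Type*} [Field K] [CommRing R] [Algebra K R]

/-- Suppose that `m ^ (n + 1)` contains all elements sent into `m` by every differential operator of
order at most `n`. Then functionals detect the elements of the module of principal parts outside
`m • ⊤`: modulo `m • ⊤` every element is represented by some `1 ⊗ f`, on which the functional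
attached to an operator `δ` takes the value `δ f`. -/
theorem PPart.exists_notMem_of_differentialPower_le {m : Ideal R} (hm : m.IsMaximal)
    [Algebra.IsSeparable K (R ⧸ m)] {n : ℕ}
    (h : differentialPower K m (n + 1) ≤ m ^ (n + 1)) {w : PPart K R n}
    (hw : w ∉ m • (⊤ : Submodule R (PPart K R n))) : ∃ φ : PPart K R n →ₗ[R] R, φ w ∉ m := by
  obtain ⟨p, rfl⟩ := Submodule.Quotient.mk_surjective _ w
  obtain ⟨f, hf⟩ := exists_sub_fibreRight_mem_pow (K := K) hm (n + 1) (Ideal.Quotient.mk _ p)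
  have hdiff : (Submodule.Quotient.mk (p - 1 ⊗ₜ f) : PPart K R n) ∈
      m • (⊤ : Submodule R (PPart K R n)) := by
    rw [PPart.mk_mem_smul_top_iff, map_sub]
    exact hf
  have hfm : f ∉ m ^ (n + 1) := by
    intro hfm
    refine hw ?_
    rw [PPart.mk_mem_smul_top_iff, ← sub_add_cancel (Ideal.Quotient.mk _ p) (fibreRight K m f)]
    refine add_mem hf ?_
    exact Ideal.le_comap_pow (f := fibreRight K m) (K := fibreIdeal K m) _
      (Ideal.pow_right_mono (fun r hr => fibreRight_mem hr) _ hfm)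
  have hfd : ¬ ∀ δ : R →ₗ[K] R, IsDiffOp K n δ → δ f ∈ m := fun hall => hfm (h hall)
  push Not at hfd
  obtain ⟨δ, hδ, hδf⟩ := hfd
  obtain ⟨φ, hφ⟩ := hδ.exists_linearMap
  refine ⟨φ, fun hφw => hδf ?_⟩
  have h1 : φ (Submodule.Quotient.mk (p - 1 ⊗ₜ f)) ∈ m := by
    have h2 := Submodule.mem_map_of_mem (f := φ) hdiff
    rw [Submodule.map_smul''] at h2
    have h3 := Submodule.smul_mono (le_refl m) (le_top (a := Submodule.map φ ⊤)) h2
    simpa using h3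
  rw [Submodule.Quotient.mk_sub, map_sub, hφ] at h1
  simpa using m.sub_mem hφw h1

theorem tensorProductTo_mem_of_mk_mem {m : Ideal R} {p : R ⊗[K] R}
    (hp : Ideal.Quotient.mk (m.map (algebraMap R (R ⊗[K] R))) p ∈ fibreIdeal K m ^ 2) :
    (KaehlerDifferential.D K R).tensorProductTo p ∈ m • (⊤ : Submodule R Ω[R⁄K]) := by
  rw [mk_mem_fibreIdeal_pow_iff] at hp
  obtain ⟨s, hs, t, ht, rfl⟩ := Submodule.mem_sup.mp hp
  rw [map_add]
  refine add_mem ?_ ?_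
  · have h1 := KaehlerDifferential.D_tensorProductTo
      (⟨s, Ideal.pow_le_self two_ne_zero hs⟩ : KaehlerDifferential.ideal K R)
    rw [(Ideal.toCotangent_eq_zero _ _).mpr hs] at h1
    exact h1 ▸ zero_mem _
  · have h1 : t ∈ m • (⊤ : Submodule R (R ⊗[K] R)) := by
      rw [Ideal.smul_top_eq_map]; exact ht
    have h2 := Submodule.mem_map_of_mem (f := (KaehlerDifferential.D K R).tensorProductTo) h1
    rw [Submodule.map_smul''] at h2
    exact Submodule.smul_mono (le_refl m) le_top h2

/-- If functionals detect the elements of the module of principal parts of some order `N ≥ 1` outside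
`m • ⊤`, then the fibre of `Ω[R⁄K]` at `m` has dimension at most the generic rank. -/
theorem le_of_detects_principalParts [IsDomain R] [Field F] [Algebra K F] [Algebra R F]
    [IsScalarTower K R F] [IsFractionRing R F] [Algebra.FormallySmooth K F]
    [Module.Finite R Ω[R⁄K]] {d : ℕ} {x : Fin d → R} (b : Module.Basis (Fin d) F Ω[F⁄K])
    (hb : ∀ i, b i = KaehlerDifferential.D K F (algebraMap R F (x i)))
    {m : Ideal R} (hm : m.IsMaximal) {N : ℕ} (hN : 1 ≤ N)
    (hdet : ∀ w : PPart K R N, w ∉ m • (⊤ : Submodule R (PPart K R N)) →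
      ∃ φ : PPart K R N →ₗ[R] R, φ w ∉ m)
    {e : ℕ} {w : Fin e → Ω[R⁄K]} (hspan : Submodule.span R (Set.range w) ⊔ m • ⊤ = ⊤)
    (hind : ∀ c : Fin e → R, ∑ i, c i • w i ∈ m • (⊤ : Submodule R Ω[R⁄K]) → ∀ i, c i ∈ m) :
    e ≤ d := by
  classical
  let I := m.map (algebraMap R (R ⊗[K] R))
  let τ := (KaehlerDifferential.D K R).tensorProductTo
  have hτ : ∀ p : KaehlerDifferential.ideal K R, τ p = KaehlerDifferential.fromIdeal K R p :=
    fun p => KaehlerDifferential.D_tensorProductTo p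
  choose y hy using fun i => KaehlerDifferential.fromIdeal_surjective K R (w i)
  let L : R ⊗[K] R →ₗ[R] TensorFibre K m := (Ideal.Quotient.mkₐ R I).toLinearMap
  have hL : ∀ p, L p = Ideal.Quotient.mk I p := fun _ => rfl
  have hI : ∀ p ∈ I, L p = 0 := fun p hp => Ideal.Quotient.eq_zero_iff_mem.mpr hp
  have hm0 : ∀ η ∈ m • (⊤ : Submodule R Ω[R⁄K]),
      ∃ q ∈ KaehlerDifferential.ideal K R, q ∈ I ∧ τ q = η := by
    intro η hη
    induction hη using Submodule.smul_induction_on' with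
    | smul r hr ω _ =>
      obtain ⟨q, rfl⟩ := KaehlerDifferential.fromIdeal_surjective K R ω
      refine ⟨algebraMap R _ r * q, Ideal.mul_mem_left _ _ q.2,
        Ideal.mul_mem_right _ _ (Ideal.mem_map_of_mem _ hr), ?_⟩
      rw [← Algebra.smul_def, map_smul, hτ]
    | add a _ b _ iha ihb =>
      obtain ⟨q, hq, hqI, rfl⟩ := iha
      obtain ⟨q', hq', hqI', rfl⟩ := ihb
      exact ⟨q + q', add_mem hq hq', add_mem hqI hqI', map_add _ _ _⟩
  refine le_of_numMonomials_le (R := R) (A := TensorFibre K m) hm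
    (fun r hr => TensorFibre.algebraMap_eq_zero hr) (𝔫 := fibreIdeal K m)
    (y := fun i => L (y i)) (fun i => Ideal.mem_map_of_mem _ (y i).2)
    (exists_sub_algebraMap_mem_fibreIdeal m) ?_ ?_ hN ?_ ?_
  · intro z hz
    obtain ⟨p, hp, rfl⟩ :=
      (Ideal.mem_map_iff_of_surjective _ Ideal.Quotient.mk_surjective).mp hz
    have h1 : τ p ∈ Submodule.span R (Set.range w) ⊔ m • ⊤ := by rw [hspan]; trivial
    obtain ⟨s, hs, η, hη, hsη⟩ := Submodule.mem_sup.mp h1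
    obtain ⟨c, rfl⟩ := (Submodule.mem_span_range_iff_exists_fun R).mp hs
    obtain ⟨q, hq, hqI, rfl⟩ := hm0 η hη
    have h2 : p - (∑ i, c i • (y i : R ⊗[K] R) + q) ∈ KaehlerDifferential.ideal K R := by
      refine sub_mem hp (add_mem (Submodule.sum_mem _ fun i _ => ?_) hq)
      rw [Algebra.smul_def]
      exact Ideal.mul_mem_left _ _ (y i).2
    have h3 : τ (p - (∑ i, c i • (y i : R ⊗[K] R) + q)) = 0 := by
      rw [map_sub, map_add, map_sum, ← hsη, sub_eq_zero]
      congr 1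
      refine Finset.sum_congr rfl fun i _ => ?_
      rw [map_smul, hτ, hy]
    rw [hτ ⟨_, h2⟩] at h3
    have h4 := (Ideal.toCotangent_eq_zero _ _).mp h3
    have h5 : L p = ∑ i, c i • L (y i) + L (p - (∑ i, c i • (y i : R ⊗[K] R) + q)) := by
      rw [map_sub, map_add, map_sum, hI q hqI]
      simp only [map_smul]
      abel
    rw [← hL, h5]
    refine Submodule.add_mem_sup ((Submodule.mem_span_range_iff_exists_fun R).mpr ⟨c, rfl⟩) ?_
    rw [Submodule.restrictScalars_mem, ← Ideal.map_pow]
    exact Ideal.mem_map_of_mem _ h4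
  · intro c hc
    refine hind c ?_
    have h1 : L (∑ i, c i • (y i : R ⊗[K] R)) ∈ fibreIdeal K m ^ 2 := by
      rw [map_sum]
      simpa only [map_smul] using hc
    have h2 : τ (∑ i, c i • (y i : R ⊗[K] R)) ∈ _ := tensorProductTo_mem_of_mk_mem h1
    rw [map_sum] at h2
    convert h2 using 2 with i
    rw [map_smul, hτ, hy]
  -- lift generators of the fibre to the module of principal parts
  · intro n T hT
    choose σ hσ using fun t : TensorFibre K m => Ideal.Quotient.mk_surjective t
    let Q := ((KaehlerDifferential.ideal K R ^ (n + 1)).restrictScalars R).mkQ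
    refine (numMonomials_le_card b hb hm.ne_top (n := n) (T := T.image fun t => Q (σ t))
      ?_).trans Finset.card_image_le
    rw [eq_top_iff]
    intro z _
    obtain ⟨p, rfl⟩ := Submodule.Quotient.mk_surjective _ z
    have h1 : L p ∈ Submodule.span R (T : Set (TensorFibre K m)) ⊔
        (fibreIdeal K m ^ (n + 1)).restrictScalars R := by rw [hT]; trivial
    obtain ⟨s, hs, t, ht, hst⟩ := Submodule.mem_sup.mp h1
    have h2 : (T : Set (TensorFibre K m)) = L '' (σ '' T) := by
      rw [← Set.image_comp]
      exact ((Set.image_congr fun t _ => hσ t).trans (Set.image_id _)).symm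
    rw [h2, ← Submodule.map_span] at hs
    obtain ⟨s₀, hs₀, rfl⟩ := hs
    rw [← add_sub_cancel s₀ p, Submodule.Quotient.mk_add]
    refine Submodule.add_mem_sup ?_ ?_
    · have h3 := Submodule.mem_map_of_mem (f := Q) hs₀
      rw [Submodule.map_span, ← Set.image_comp] at h3
      rw [Finset.coe_image]
      exact h3
    · rw [PPart.mk_mem_smul_top_iff, ← hL, map_sub, ← hst, add_sub_cancel_left]
      exact ht
  -- lift an independent family of the fibre to the module of principal parts
  · intro k v hv
    choose v₀ hv₀ using fun i => Ideal.Quotient.mk_surjective (v i)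
    have h1 : LinearIndependent R fun i => (Submodule.Quotient.mk (v₀ i) : PPart K R N) := by
      refine linearIndependent_of_detects hm hdet fun c hc => hv c ?_
      have h2 : (Submodule.Quotient.mk (∑ i, c i • v₀ i) : PPart K R N) ∈
          m • (⊤ : Submodule R (PPart K R N)) := by
        rw [← Submodule.mkQ_apply, map_sum]
        exact hc
      rw [PPart.mk_mem_smul_top_iff, ← hL, map_sum] at h2
      convert h2 using 2 with i
      rw [map_smul, hL, hv₀]
    simpa using h1.card_le_numMonomials b hb

end Comparison

/-! ### Principal parts of order one and second differential powers -/

section Free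

variable {K R : Type*} [CommRing K] [CommRing R] [Algebra K R]

/-- The module of principal parts of order one is `R × Ω[R⁄K]`. -/
noncomputable def PPart.equivProd : PPart K R 1 ≃ₗ[R] R × Ω[R⁄K] := by
  let μ : R ⊗[K] R →ₗ[R] R := (Algebra.TensorProduct.lmul'' K (S := R)).toLinearMap
  let τ := (KaehlerDifferential.D K R).tensorProductTo
  have hμ : ∀ p, μ p = Algebra.TensorProduct.lmul' K p := fun _ => rfl
  have hτ : ∀ p : KaehlerDifferential.ideal K R, τ p = KaehlerDifferential.fromIdeal K R p :=
    fun p => KaehlerDifferential.D_tensorProductTo p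
  have hker : LinearMap.ker (μ.prod τ) =
      (KaehlerDifferential.ideal K R ^ (1 + 1)).restrictScalars R := by
    ext p
    change (μ p, τ p) = 0 ↔ p ∈ KaehlerDifferential.ideal K R ^ (1 + 1)
    rw [Prod.mk_eq_zero]
    constructor
    · rintro ⟨h1, h2⟩
      have h3 := hτ ⟨p, h1⟩
      rw [h2] at h3
      exact (Ideal.toCotangent_eq_zero _ _).mp h3.symm
    · intro hp
      have hp' := Ideal.pow_le_self two_ne_zero hp
      refine ⟨hp', ?_⟩
      rw [hτ ⟨p, hp'⟩]
      exact (Ideal.toCotangent_eq_zero _ _).mpr hp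
  have hsurj : LinearMap.range (μ.prod τ) = ⊤ := by
    rw [eq_top_iff]
    rintro ⟨r, ω⟩ -
    obtain ⟨p, rfl⟩ := KaehlerDifferential.tensorProductTo_surjective K R ω
    refine ⟨p + (r - μ p) ⊗ₜ 1, ?_⟩
    simp [hμ, τ, Derivation.tensorProductTo_tmul]
  exact (Submodule.quotEquivOfEq _ _ hker.symm).trans
    ((μ.prod τ).quotKerEquivOfSurjective (LinearMap.range_eq_top.mp hsurj))

theorem sq_le_differentialPower (m : Ideal R) : m ^ 2 ≤ differentialPower K m 2 := by
  rw [pow_two, Ideal.mul_le]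
  intro a ha b hb δ hδ
  have h1 : ∀ r x : R, δ (a * (r * x)) - a * δ (r * x) = r * (δ (a * x) - a * δ x) := by
    intro r x
    have h2 : ∀ r x : R, _ = _ := hδ a
    simpa using h2 r x
  have h2 : δ (a * b) = a * δ b + b * (δ a - a * δ 1) := by
    have := h1 b 1
    simp only [mul_one] at this
    rw [← this, add_sub_cancel]
  rw [h2]
  exact add_mem (Ideal.mul_mem_right _ _ ha) (Ideal.mul_mem_right _ _ hb)

end Free

section Sep

variable {K R : Type*} [Field K] [CommRing R] [Algebra K R]

/-- For `R ⧸ m` separable over `K`, the map `m ⧸ m ^ 2 → Ω[R⁄K] ⧸ m Ω[R⁄K]` is injective: a section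
`σ` of `R ⧸ m ^ 2 → R ⧸ m` gives the derivation `r ↦ r - σ r` with values in `m ⧸ m ^ 2`. -/
theorem mem_sq_of_D_mem_smul {m : Ideal R} (hm : m.IsMaximal) [Algebra.IsSeparable K (R ⧸ m)]
    {f : R} (hf : f ∈ m) (hD : KaehlerDifferential.D K R f ∈ m • (⊤ : Submodule R Ω[R⁄K])) :
    f ∈ m ^ 2 := by
  let _ := Ideal.Quotient.field m
  have : Algebra.FormallyEtale K (R ⧸ m) := Algebra.FormallyEtale.of_isSeparable K (R ⧸ m)
  let q : R ⧸ m ^ 2 →ₐ[K] R ⧸ m := Ideal.Quotient.factorₐ K (Ideal.pow_le_self two_ne_zero)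
  have hq : ∀ r, q (Ideal.Quotient.mk _ r) = Ideal.Quotient.mk m r := fun _ => rfl
  have hqs : Function.Surjective q := fun z => by
    obtain ⟨r, rfl⟩ := Ideal.Quotient.mk_surjective z
    exact ⟨_, hq r⟩
  have hmul : ∀ a b, q a = 0 → q b = 0 → a * b = 0 := by
    intro a b ha hb
    obtain ⟨a, rfl⟩ := Ideal.Quotient.mk_surjective a
    obtain ⟨b, rfl⟩ := Ideal.Quotient.mk_surjective b
    rw [hq, Ideal.Quotient.eq_zero_iff_mem] at ha hb
    rw [← map_mul, Ideal.Quotient.eq_zero_iff_mem, pow_two]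
    exact Ideal.mul_mem_mul ha hb
  have hnil : IsNilpotent (RingHom.ker (q : R ⧸ m ^ 2 →+* R ⧸ m)) := by
    refine ⟨2, (pow_two _).trans ?_⟩
    rw [Ideal.zero_eq_bot, eq_bot_iff, Ideal.mul_le]
    exact fun a ha b hb => hmul a b ha hb
  let σ : R ⧸ m →ₐ[K] R ⧸ m ^ 2 :=
    Algebra.FormallySmooth.liftOfSurjective (AlgHom.id K (R ⧸ m)) q hqs hnil
  have hσ : ∀ z, q (σ z) = z := fun z =>
    Algebra.FormallySmooth.liftOfSurjective_apply (AlgHom.id K (R ⧸ m)) q hqs hnil z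
  let τ : R →ₗ[K] R ⧸ m ^ 2 := (Ideal.Quotient.mkₐ K (m ^ 2)).toLinearMap -
    σ.toLinearMap ∘ₗ (Ideal.Quotient.mkₐ K m).toLinearMap
  have hτ : ∀ r, τ r = Ideal.Quotient.mk _ r - σ (Ideal.Quotient.mk m r) := fun _ => rfl
  have hqτ : ∀ r, q (τ r) = 0 := fun r => by rw [hτ, map_sub, hσ, hq, sub_self]
  let D : Derivation K R (R ⧸ m ^ 2) := Derivation.mk' τ fun a b => by
    have h1 := hmul _ _ (hqτ a) (hqτ b)
    rw [hτ a, hτ b] at h1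
    rw [Algebra.smul_def, Algebra.smul_def, hτ, hτ, hτ, map_mul, map_mul, map_mul,
      Ideal.Quotient.algebraMap_eq]
    linear_combination -h1
  let ℓ := D.liftKaehlerDifferential
  have hℓ : ∀ ω, q (ℓ ω) = 0 := by
    intro ω
    have hω : ω ∈ Submodule.span R (Set.range (KaehlerDifferential.D K R)) := by
      rw [KaehlerDifferential.span_range_derivation]; trivial
    induction hω using Submodule.span_induction with
    | mem x hx =>
      obtain ⟨r, rfl⟩ := hx
      rw [Derivation.liftKaehlerDifferential_comp_D]
      exact hqτ r
    | zero => simp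
    | add x y _ _ hx hy => rw [map_add, map_add, hx, hy, add_zero]
    | smul r x _ hx => rw [map_smul, Algebra.smul_def, map_mul, hx, mul_zero]
  have hℓm : ∀ ω ∈ m • (⊤ : Submodule R Ω[R⁄K]), ℓ ω = 0 := by
    intro ω hω
    induction hω using Submodule.smul_induction_on' with
    | add x _ y _ hx hy => rw [map_add, hx, hy, add_zero]
    | smul r hr x _ =>
      rw [map_smul, Algebra.smul_def]
      exact hmul _ _ ((hq r).trans (Ideal.Quotient.eq_zero_iff_mem.mpr hr)) (hℓ x)
  have h1 := hℓm _ hD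
  rw [Derivation.liftKaehlerDifferential_comp_D] at h1
  have h2 : Ideal.Quotient.mk (m ^ 2) f = 0 := by
    have h3 : τ f = 0 := h1
    rwa [hτ, Ideal.Quotient.eq_zero_iff_mem.mpr hf, map_zero, sub_zero] at h3
  exact Ideal.Quotient.eq_zero_iff_mem.mp h2

/-- If `Ω[R⁄K]` is projective, then derivations detect `m ⧸ m ^ 2`. -/
theorem differentialPower_two_eq [Module.Projective R Ω[R⁄K]] {m : Ideal R} (hm : m.IsMaximal)
    [Algebra.IsSeparable K (R ⧸ m)] : differentialPower K m 2 = m ^ 2 := by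
  refine le_antisymm (fun f hf => ?_) (sq_le_differentialPower m)
  have hfm : f ∈ m := hf LinearMap.id fun r s x => by simp
  by_contra hf2
  obtain ⟨φ, hφ⟩ := Module.Projective.exists_notMem
    (fun hD => hf2 (mem_sq_of_D_mem_smul (K := K) hm hfm hD))
  refine hφ (hf (φ.compDer (KaehlerDifferential.D K R) : R →ₗ[K] R) fun r s x => ?_)
  simp
  ring

end Sep

/-! ### Freeness of the differentials -/

section Generators

variable {K R F : Type*} [Field K] [CommRing R] [Algebra K R]

/-- If `Ω[R⁄K]` is generated by as many elements as its generic rank, it is free. -/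
theorem free_of_span_eq_top [IsDomain R] [Field F] [Algebra K F] [Algebra R F]
    [IsScalarTower K R F] [IsFractionRing R F] {d : ℕ} (b : Module.Basis (Fin d) F Ω[F⁄K])
    {e : ℕ} {w : Fin e → Ω[R⁄K]} (hw : Submodule.span R (Set.range w) = ⊤) (hed : e ≤ d) :
    Module.Free R Ω[R⁄K] := by
  have h1 : Submodule.span F (Set.range (KaehlerDifferential.map K K R F ∘ w)) = ⊤ := by
    rw [Set.range_comp]
    exact span_eq_top_of_isLocalizedModule F (nonZeroDivisors R)
      (KaehlerDifferential.map K K R F) hw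
  have hfr : Module.finrank F Ω[F⁄K] = d := by rw [Module.finrank_eq_card_basis b]; simp
  have hde : e = d := by
    refine le_antisymm hed ?_
    rw [← hfr, ← finrank_top, ← h1]
    exact (finrank_range_le_card _).trans (by simp)
  have h2 := linearIndependent_of_top_le_span_of_card_eq_finrank h1.ge (by simp [hfr, hde])
  have h3 : LinearIndependent R w := by
    rw [Fintype.linearIndependent_iff] at h2 ⊢
    intro g hg i
    have h4 := h2 (fun i => algebraMap R F (g i)) ?_ i
    · exact (map_eq_zero_iff _ (IsFractionRing.injective R F)).mp h4
    · have h5 := congrArg (KaehlerDifferential.map K K R F) hg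
      rw [map_sum, map_zero] at h5
      rw [← h5]
      refine Finset.sum_congr rfl fun i _ => ?_
      rw [map_smul, algebraMap_smul]
      rfl
  exact Module.Free.of_basis (Module.Basis.mk h3 hw.ge)

theorem span_range_D_eq_top_of_adjoin {ι : Type*} {x : ι → R}
    (hx : Algebra.adjoin K (Set.range x) = ⊤) :
    Submodule.span R (Set.range fun i => KaehlerDifferential.D K R (x i)) = ⊤ := by
  rw [eq_top_iff, ← KaehlerDifferential.span_range_derivation, Submodule.span_le]
  rintro _ ⟨f, rfl⟩
  have hf : f ∈ Algebra.adjoin K (Set.range x) := by rw [hx]; trivial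
  induction hf using Algebra.adjoin_induction with
  | mem f hf =>
    obtain ⟨i, rfl⟩ := hf
    exact Submodule.subset_span ⟨i, rfl⟩
  | algebraMap c => simp
  | add a b _ _ ha hb => rw [map_add]; exact add_mem ha hb
  | mul a b _ _ ha hb =>
    rw [Derivation.leibniz]
    exact add_mem (Submodule.smul_mem _ _ hb) (Submodule.smul_mem _ _ ha)

end Generators

/-! ### Graded algebras -/

section Graded

variable {K R : Type*} [Field K] [CommRing R] [Algebra K R] (𝒜 : ℕ → Submodule K R)
  [GradedAlgebra 𝒜]

theorem decompose_zero_of_mem_irrelevant {f : R}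
    (hf : f ∈ (HomogeneousIdeal.irrelevant 𝒜).toIdeal) :
    (DirectSum.decompose 𝒜 f 0 : R) = 0 := by
  rwa [HomogeneousIdeal.mem_iff, HomogeneousIdeal.mem_irrelevant_iff, GradedRing.proj_apply] at hf

theorem mem_irrelevant_of_mem {n : ℕ} (hn : n ≠ 0) {f : R} (hf : f ∈ 𝒜 n) :
    f ∈ (HomogeneousIdeal.irrelevant 𝒜).toIdeal := by
  rw [HomogeneousIdeal.mem_iff, HomogeneousIdeal.mem_irrelevant_iff, GradedRing.proj_apply]
  exact DirectSum.decompose_of_mem_ne 𝒜 hf hn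

theorem span_D_homogeneous_eq_top (h0 : 𝒜 0 = 1) :
    Submodule.span R (KaehlerDifferential.D K R '' {f | ∃ n ≠ 0, f ∈ 𝒜 n}) = ⊤ := by
  classical
  rw [eq_top_iff, ← KaehlerDifferential.span_range_derivation, Submodule.span_le]
  rintro _ ⟨f, rfl⟩
  rw [← DirectSum.sum_support_decompose 𝒜 f, map_sum]
  refine Submodule.sum_mem _ fun n _ => ?_
  by_cases hn : n = 0
  · subst hn
    obtain ⟨c, hc⟩ := Submodule.mem_one.mp (h0.le (DirectSum.decompose 𝒜 f 0).2)
    rw [← hc, Derivation.map_algebraMap]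
    exact zero_mem _
  · exact Submodule.subset_span ⟨_, ⟨n, hn, (DirectSum.decompose 𝒜 f n).2⟩, rfl⟩

/-- Homogeneous elements generating the irrelevant ideal modulo its square generate the algebra. -/
theorem adjoin_eq_top_of_irrelevant (h0 : 𝒜 0 = 1) {ι : Type*} [Fintype ι] {x : ι → R}
    (hx : ∀ i, ∃ n, x i ∈ 𝒜 n)
    (hgen : ∀ f ∈ (HomogeneousIdeal.irrelevant 𝒜).toIdeal,
      ∃ c : ι → K, f - ∑ i, c i • x i ∈ (HomogeneousIdeal.irrelevant 𝒜).toIdeal ^ 2) :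
    Algebra.adjoin K (Set.range x) = ⊤ := by
  classical
  set S := Algebra.adjoin K (Set.range x)
  have key : ∀ n, ∀ f ∈ 𝒜 n, f ∈ S := by
    intro n
    induction n using Nat.strong_induction_on with
    | _ n ih =>
    intro f hf
    by_cases hn : n = 0
    · subst hn
      obtain ⟨c, rfl⟩ := Submodule.mem_one.mp (h0.le hf)
      exact S.algebraMap_mem c
    -- the degree `n` part of a product of elements of positive degree involves lower degrees only
    have hsq : ∀ z ∈ (HomogeneousIdeal.irrelevant 𝒜).toIdeal ^ 2,
        GradedRing.proj 𝒜 n z ∈ S := by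
      intro z hz
      rw [pow_two] at hz
      induction hz using Submodule.mul_induction_on' with
      | add a _ b _ ha hb => rw [map_add]; exact add_mem ha hb
      | mem_mul_mem a ha b hb =>
        rw [← DirectSum.sum_support_decompose 𝒜 a, ← DirectSum.sum_support_decompose 𝒜 b,
          Finset.sum_mul_sum, map_sum]
        refine Subalgebra.sum_mem _ fun p _ => ?_
        rw [map_sum]
        refine Subalgebra.sum_mem _ fun q _ => ?_
        have hmem : (DirectSum.decompose 𝒜 a p : R) * DirectSum.decompose 𝒜 b q ∈ 𝒜 (p + q) :=
          SetLike.mul_mem_graded (DirectSum.decompose 𝒜 a p).2 (DirectSum.decompose 𝒜 b q).2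
        by_cases hp : p = 0
        · rw [hp, decompose_zero_of_mem_irrelevant 𝒜 ha, zero_mul, map_zero]
          exact zero_mem _
        by_cases hq : q = 0
        · rw [hq, decompose_zero_of_mem_irrelevant 𝒜 hb, mul_zero, map_zero]
          exact zero_mem _
        rw [GradedRing.proj_apply]
        by_cases hpq : p + q = n
        · rw [hpq] at hmem
          rw [DirectSum.decompose_of_mem_same 𝒜 hmem]
          exact mul_mem (ih p (by omega) _ (DirectSum.decompose 𝒜 a p).2)
            (ih q (by omega) _ (DirectSum.decompose 𝒜 b q).2)
        · rw [DirectSum.decompose_of_mem_ne 𝒜 hmem hpq]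
          exact zero_mem _
    obtain ⟨c, hc⟩ := hgen f (mem_irrelevant_of_mem 𝒜 hn hf)
    have h1 := hsq _ hc
    rw [map_sub, GradedRing.proj_apply, DirectSum.decompose_of_mem_same 𝒜 hf, map_sum] at h1
    have h2 : ∑ i, GradedRing.proj 𝒜 n (c i • x i) ∈ S := by
      refine Subalgebra.sum_mem _ fun i _ => ?_
      obtain ⟨k, hk⟩ := hx i
      have hk' : c i • x i ∈ 𝒜 k := Submodule.smul_mem _ _ hk
      rw [GradedRing.proj_apply]
      by_cases hkn : k = n
      · subst hkn
        rw [DirectSum.decompose_of_mem_same 𝒜 hk']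
        exact S.smul_mem (Algebra.subset_adjoin ⟨i, rfl⟩ : x i ∈ S) _
      · rw [DirectSum.decompose_of_mem_ne 𝒜 hk' hkn]
        exact zero_mem _
    simpa using add_mem h1 h2
  rw [eq_top_iff]
  intro f _
  rw [← DirectSum.sum_support_decompose 𝒜 f]
  exact Subalgebra.sum_mem _ fun n _ => key n _ (DirectSum.decompose 𝒜 f n).2

end Graded

/-! ### Algebras with pseudocoefficient fields -/

theorem IsSeparableExtension.formallySmooth {K F : Type*} [Field K] [Field F] [Algebra K F]
    [Algebra.EssFiniteType K F] (h : IsSeparableExtension K F) : Algebra.FormallySmooth K F := by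
  obtain ⟨s, hs, hsep⟩ := h ⊤ (IntermediateField.fg_top K F)
  have : Algebra.IsSeparable
      (IntermediateField.adjoin K (Set.range (Subtype.val : s → (⊤ : IntermediateField K F))))
      (⊤ : IntermediateField K F) := by
    rw [Subtype.range_coe]
    exact hsep
  have := Algebra.FormallySmooth.of_algebraicIndependent_of_isSeparable hs.1
  exact .of_equiv (IntermediateField.topEquiv (F := K) (E := F))

section Pseudocoefficient

variable {K R F : Type*} [Field K] [CommRing R] [Algebra K R] {m : Ideal R}

theorem IsPseudocoefficientAlgebra.essFiniteType (h : IsPseudocoefficientAlgebra K R m) :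
    Algebra.EssFiniteType K R := by
  obtain ⟨𝒜, _, -, _, -⟩ | ⟨_, h, -⟩ := h.graded_or_local
  · infer_instance
  · exact h

/-- If the fibre of `Ω[R⁄K]` at `m` has dimension at most the generic rank, then `Ω[R⁄K]` is free.
In the local case this is Nakayama's lemma. In the graded case one finds homogeneous elements, at most
as many as the generic rank, whose differentials generate the fibre; these generate `m` modulo
`m ^ 2`, hence the algebra. -/
theorem IsPseudocoefficientAlgebra.free_kaehlerDifferential [IsDomain R] [Field F] [Algebra K F]
    [Algebra R F] [IsScalarTower K R F] [IsFractionRing R F]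
    (h : IsPseudocoefficientAlgebra K R m) {d : ℕ} (b : Module.Basis (Fin d) F Ω[F⁄K])
    (hle : ∀ (e : ℕ) (w : Fin e → Ω[R⁄K]), Submodule.span R (Set.range w) ⊔ m • ⊤ = ⊤ →
      (∀ c : Fin e → R, ∑ i, c i • w i ∈ m • (⊤ : Submodule R Ω[R⁄K]) → ∀ i, c i ∈ m) → e ≤ d) :
    Module.Free R Ω[R⁄K] := by
  have hm := h.isMaximal
  have := h.essFiniteType
  have := h.separable_residue
  rcases h.graded_or_local with ⟨𝒜, _, h0, -, rfl⟩ | ⟨_, -, rfl⟩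
  · obtain ⟨e, w, hw, hspan, hind⟩ :=
      exists_minimal_generators_mod hm (span_D_homogeneous_eq_top 𝒜 h0)
    choose x hx hxw using hw
    refine free_of_span_eq_top b (w := fun i => KaehlerDifferential.D K R (x i)) ?_
      (hle e w hspan hind)
    refine span_range_D_eq_top_of_adjoin (adjoin_eq_top_of_irrelevant 𝒜 h0
      (fun i => (hx i).imp fun n hn => hn.2) fun f hf => ?_)
    have h1 : KaehlerDifferential.D K R f ∈ Submodule.span R (Set.range w) ⊔
        (HomogeneousIdeal.irrelevant 𝒜).toIdeal • ⊤ := by rw [hspan]; trivial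
    obtain ⟨s, hs, t, ht, hst⟩ := Submodule.mem_sup.mp h1
    obtain ⟨r, rfl⟩ := (Submodule.mem_span_range_iff_exists_fun R).mp hs
    -- the coefficients may be replaced by their constant terms
    have hr : ∀ i, ∃ c : K, r i - algebraMap K R c ∈ (HomogeneousIdeal.irrelevant 𝒜).toIdeal := by
      intro i
      have h2 : (DirectSum.decompose 𝒜 (r i) 0 : R) ∈ 𝒜 0 := SetLike.coe_mem _
      obtain ⟨c, hc⟩ := Submodule.mem_one.mp (h0.le h2)
      refine ⟨c, ?_⟩
      rw [hc, HomogeneousIdeal.mem_iff, HomogeneousIdeal.mem_irrelevant_iff, map_sub,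
        GradedRing.proj_apply, GradedRing.proj_apply, DirectSum.decompose_of_mem_same 𝒜 h2,
        sub_self]
    choose c hc using hr
    refine ⟨c, mem_sq_of_D_mem_smul (K := K) hm ?_ ?_⟩
    · refine sub_mem hf (Submodule.sum_mem _ fun i _ => ?_)
      obtain ⟨n, hn, hxn⟩ := hx i
      rw [Algebra.smul_def]
      exact Ideal.mul_mem_left _ _ (mem_irrelevant_of_mem 𝒜 hn hxn)
    · have h3 : KaehlerDifferential.D K R (f - ∑ i, c i • x i) =
          ∑ i, (r i - algebraMap K R (c i)) • w i + t := by
        rw [map_sub, ← hst, map_sum]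
        simp only [sub_smul, Finset.sum_sub_distrib, Derivation.map_smul, hxw, algebraMap_smul]
        abel
      rw [h3]
      exact add_mem (Submodule.sum_mem _ fun i _ => Submodule.smul_mem_smul (hc i) trivial) ht
  · obtain ⟨e, w, -, hspan, hind⟩ :=
      exists_minimal_generators_mod (M := Ω[R⁄K]) hm Submodule.span_univ
    refine free_of_span_eq_top b (w := w) ?_ (hle e w hspan hind)
    rw [eq_top_iff]
    exact Submodule.le_of_le_smul_of_le_jacobson_bot Module.Finite.fg_top
      (IsLocalRing.maximalIdeal_le_jacobson ⊥) hspan.ge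

end Pseudocoefficient

theorem mainTheorem2 {K R : Type*} [Field K] [CommRing R] [IsDomain R] [Algebra K R]
    (m : Ideal R) (h : IsPseudocoefficientAlgebra K R m)
    (hsep : IsSeparableExtension K (FractionRing R)) :
    ((∃ n : ℕ, 2 ≤ n ∧ differentialPower K m n = m ^ n) ↔ IsSmoothOver K R) ∧
    (@PerfectField (R ⧸ m) (@Ideal.Quotient.field R _ m h.isMaximal) →
      (IsSmoothOver K R ↔ ∃ n : ℕ, 1 ≤ n ∧ Module.Free R (PrincipalParts K R n))) := by
  have hm := h.isMaximal
  have := h.separable_residue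
  have := h.essFiniteType
  have : Algebra.EssFiniteType R (FractionRing R) := .of_isLocalization _ (nonZeroDivisors R)
  have : Algebra.EssFiniteType K (FractionRing R) := .comp K R _
  have := hsep.formallySmooth
  obtain ⟨d, x, b, hb⟩ := exists_isBasis_D (K := K) (R := R) (F := FractionRing R)
  -- functionals detecting the fibre of the principal parts of some order force smoothness
  have hfree : ∀ N, 1 ≤ N → (∀ w : PPart K R N, w ∉ m • (⊤ : Submodule R (PPart K R N)) →
      ∃ φ : PPart K R N →ₗ[R] R, φ w ∉ m) → Module.Free R Ω[R⁄K] := fun N hN hdet =>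
    h.free_kaehlerDifferential b fun e w hspan hind =>
      le_of_detects_principalParts b hb hm hN hdet hspan hind
  have hproj : Module.Projective R Ω[R⁄K] → Module.Free R Ω[R⁄K] := fun _ =>
    h.free_kaehlerDifferential b fun e w _ hind => by
      simpa using (linearIndependent_of_detects hm
        (fun _ => Module.Projective.exists_notMem) hind).card_le_of_isBasis_D b hb
  refine ⟨⟨?_, fun hs => ?_⟩, fun _ => ⟨fun hs => ?_, ?_⟩⟩
  · rintro ⟨n, hn, heq⟩
    obtain ⟨N, rfl⟩ : ∃ N, n = N + 1 := ⟨n - 1, by omega⟩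
    have := hfree N (by omega) fun w =>
      PPart.exists_notMem_of_differentialPower_le hm heq.le
    exact ⟨inferInstance, inferInstance⟩
  · have := hs.2
    exact ⟨2, le_rfl, differentialPower_two_eq hm⟩
  · have := hproj hs.2
    exact ⟨1, le_rfl, Module.Free.of_equiv
      (PPart.equivProd.symm.trans (Submodule.Quotient.restrictScalarsEquiv R _))⟩
  · rintro ⟨N, hN, hF⟩
    have hF' : Module.Free R (PPart K R N) :=
      Module.Free.of_equiv (Submodule.Quotient.restrictScalarsEquiv R
        (KaehlerDifferential.ideal K R ^ (N + 1))).symm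
    have := hfree N hN fun w => Module.Projective.exists_notMem
    exact ⟨inferInstance, inferInstance⟩
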